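/- Let $p\ge 1$ be an integer, let $\mathcal{E}_p=\{(z_1,z_2)\in\mathbb{C}^2:|z_1|^{2p}+|z_2|^{2p}<1\}$ and $\mathcal{E}_p^*=\mathcal{E}_p\setminus\{z_2=0\}$. Let $\sigma$ be the Euclidean surface area measure on the boundary $b\mathcal{E}_p$, and let $\omega_p=j^*(d^c\varphi_p\wedge dd^c\varphi_p)$ be the Monge–Ampère boundary measure of the exhaustion function $\varphi_p(z)=\frac1{2p}\log(|z_1|^{2p}+|z_2|^{2p})$, where $j:b\mathcal{E}_p\to\mathbb{C}^2$ is the inclusion and $d^c=i(\overline\partial-\partial)$. For $\nu\in\{\sigma,\omega_p\}$ with support $T$, let $\mathcal{A}(\mathcal{E}_p,\nu)$ be the space of continuous functions on $\mathcal{E}_p\cup T$ that are holomorphic on $\mathcal{E}_p$. For an integer $k\ge 0$ let $\mathcal{A}_k(\mathcal{E}_p^*,\nu)$ be the space of functions $F=z_2^{-k}G$ on $(\mathcal{E}_p\cup T)\setminus\{z_2=0\}$ with $G\in\mathcal{A}(\mathcal{E}_p,\nu)$ whose restriction to $T\setminus\{z_2=0\}$ (extended by $0$ to the $\nu$-null set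 $T\cap\{z_2=0\}$) lies in $L^2(\nu)$, and let $\mathfrak{H}^2_k(\mathcal{E}_p^*,\nu)$ be the closure in $L^2(\nu)$ of the set of these restrictions. Then: 1. $\mathfrak{H}^2_k(\mathcal{E}_p^*,\sigma)=\mathfrak{H}^2_0(\mathcal{E}_p^*,\sigma)$ for all $k\ge 0$. 2. $\mathfrak{H}^2_0(\mathcal{E}_p^*,\omega_p)\subsetneq\mathfrak{H}^2_1(\mathcal{E}_p^*,\omega_p)\subsetneq\cdots\subsetneq\mathfrak{H}^2_{p-1}(\mathcal{E}_p^*,\omega_p)=\mathfrak{H}^2_k(\mathcal{E}_p^*,\omega_p)$ for all $k\ge p$. 3. $\mathfrak{H}^2_0(\mathcal{E}_p^*,\omega_p)\supsetneq z_2\,\mathfrak{H}^2_1(\mathcal{E}_p^*,\omega_p)\supsetneq\cdots\supsetneq z_2^k\,\mathfrak{H}^2_k(\mathcal{E}_p^*,\omega_p)\supsetneq z_2^{k+1}\,\mathfrak{H}^2_{k+1}(\mathcal{E}_p^*,\omega_p)\supsetneq\cdots$, an infinite chain, where $z_2^k S=\{z_2^k g: g\in S\}$. -/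

import Mathlib

open MeasureTheory Set
open scoped ENNReal Gradient

noncomputable section

/-- `ℂ²` with its Euclidean norm. -/
abbrev C2 : Type := EuclideanSpace ℂ (Fin 2)

/-- The egg domain `{|z₁|^{2p} + |z₂|^{2p} < 1}`. -/
def egg (p : ℕ) : Set C2 := {z | ‖z 0‖ ^ (2 * p) + ‖z 1‖ ^ (2 * p) < 1}

/-- Euclidean surface area on the boundary of `Ω ⊆ ℂ²`, as a measure on `ℂ²`: the
three-dimensional Hausdorff measure, normalized as Lebesgue measure, on `bΩ`. -/
def surfaceMeasure (Ω : Set C2) : Measure C2 := (μHE[3]).restrict (frontier Ω)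

/-- The one-form `dᶜφ = i(∂̄φ - ∂φ)` of a real function, evaluated at `z` on a real tangent
vector `v`. Since `∂φ(v) = (dφ(v) - i dφ(iv))/2` and `∂̄φ(v) = (dφ(v) + i dφ(iv))/2`, this is
`-dφ(iv)`. -/
def dc (φ : C2 → ℝ) (z v : C2) : ℝ := -(fderiv ℝ φ z (Complex.I • v))

/-- The two-form `ddᶜφ`, the exterior derivative of `dᶜφ`. -/
def ddc (φ : C2 → ℝ) (z v w : C2) : ℝ :=
  fderiv ℝ (fun x => dc φ x w) z v - fderiv ℝ (fun x => dc φ x v) z w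

/-- The three-form `dᶜφ ∧ ddᶜφ`. -/
def dcWedgeDdc (φ : C2 → ℝ) (z u v w : C2) : ℝ :=
  dc φ z u * ddc φ z v w - dc φ z v * ddc φ z u w + dc φ z w * ddc φ z u v

/-- The unit vector in the direction of the gradient of `φ`. -/
def unitNormal (φ : C2 → ℝ) (z : C2) : C2 := (‖∇ φ z‖⁻¹ : ℝ) • ∇ φ z

/-- A unit vector that is complex orthogonal to the unit vector `n`. -/
def complexTangent (n : C2) : C2 := !₂[-(starRingEnd ℂ (n 1)), starRingEnd ℂ (n 0)]

/-- The Monge–Ampère boundary measure `j^*(dᶜφ ∧ ddᶜφ)` of `Ω = {φ < 0}`, where `j` is the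
inclusion of `bΩ`. For the outer unit normal `n` and `τ = complexTangent n`, the vectors
`(i n, τ, i τ)` form a positively oriented orthonormal basis of the real tangent space
of `bΩ`, so the density of the three-form with respect to surface area is its value
on this basis. -/
def mongeAmpereBoundaryMeasure (Ω : Set C2) (φ : C2 → ℝ) : Measure C2 :=
  (surfaceMeasure Ω).withDensity fun z =>
    let n := unitNormal φ z
    let τ := complexTangent n
    ENNReal.ofReal (dcWedgeDdc φ z (Complex.I • n) τ (Complex.I • τ))

/-- The exhaustion function `(1/2p) log (|z₁|^{2p} + |z₂|^{2p})` of the egg. -/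
def eggExhaustion (p : ℕ) (z : C2) : ℝ :=
  1 / (2 * (p : ℝ)) * Real.log (‖z 0‖ ^ (2 * p) + ‖z 1‖ ^ (2 * p))

/-- Surface area `σ` on the boundary of the egg. -/
def eggSigma (p : ℕ) : Measure C2 := surfaceMeasure (egg p)

/-- The Monge–Ampère boundary measure `ω_p` of the egg. -/
def eggOmega (p : ℕ) : Measure C2 := mongeAmpereBoundaryMeasure (egg p) (eggExhaustion p)

/-- `𝒜(Ω, ν) = 𝒪(Ω) ∩ 𝒞(Ω ∪ T)` with `T = supp ν`. Functions on `Ω ∪ T` are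
represented by functions on `ℂ²`, whose values off `Ω ∪ T` play no role. -/
def holoCont (Ω : Set C2) (ν : Measure C2) : Set (C2 → ℂ) :=
  {G | DifferentiableOn ℂ G Ω ∧ ContinuousOn G (Ω ∪ ν.support)}

/-- `𝒜_k(Ω^*, ν)` for `Ω^* = Ω \ V`, `V = {ψ = 0}`: the functions that equal `ψ^{-k} G` on
`(Ω ∪ T) \ V` for some `G ∈ 𝒜(Ω, ν)`, are extended by zero to `T ∩ V`, and
have square integrable boundary values. -/
def holoContPole (Ω : Set C2) (ν : Measure C2) (ψ : C2 → ℂ) (k : ℕ) : Set (C2 → ℂ) :=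
  {F | (∃ G ∈ holoCont Ω ν, ∀ z ∈ Ω ∪ ν.support, ψ z ≠ 0 → F z = (ψ z ^ k)⁻¹ * G z) ∧
    (∀ z ∈ ν.support, ψ z = 0 → F z = 0) ∧ MemLp F 2 ν}

/-- The `k`-th Hardy space `𝔥²_k(Ω^*, ν)`: the closure of the boundary values of
`𝒜_k(Ω^*, ν)` in `L²(ν)`. -/
def hardySpace (Ω : Set C2) (ν : Measure C2) (ψ : C2 → ℂ) (k : ℕ) : Set (Lp ℂ 2 ν) :=
  closure {f : Lp ℂ 2 ν | ∃ F ∈ holoContPole Ω ν ψ k, f =ᵐ[ν] F}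

/-- The set `ψ^ℓ S = {ψ^ℓ g : g ∈ S}` for `S ⊆ L²(ν)`. -/
def mulPowSet {ν : Measure C2} (ψ : C2 → ℂ) (l : ℕ) (S : Set (Lp ℂ 2 ν)) : Set (Lp ℂ 2 ν) :=
  {f | ∃ g ∈ S, f =ᵐ[ν] fun z => ψ z ^ l * g z}

/-- The minimal defining function `z₂` of the hyperplane `{z₂ = 0}`. -/
def z2 (z : C2) : ℂ := z 1

end

/-! The two-torus acts on `ℂ²` by rotating the coordinates, and it preserves the egg, surface area
and the Monge–Ampère measure. For `F = z₂⁻ᵏ G` and a point `z` of the support off the axes, `t ↦ F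
(torusRot t z)` is a continuous function on the torus. By Cauchy's formula in each variable its
`n`-th Fourier coefficient is `C n` times the Laurent monomial `z₁^(n 0) z₂^(n 1)`, and `C n`
vanishes unless `n 0 ≥ 0` and `n 1 ≥ -k` (`exists_coeff_of_mem_holoContPole`). Integrating Bessel's
inequality and Parseval's identity over the orbits shows that every monomial that occurs is square
integrable and that the partial sums converge to `F` in `L²` (`tendsto_eLpNorm_sub_partialSum`).
Thus the `k`-th Hardy space is the closed span of the square integrable monomials with `n 0 ≥ 0` and
`n 1 ≥ -k`.

Claims 1 and 2 therefore reduce to deciding which negative powers of `z₂` are square integrable. The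
part of the boundary with `|z₂|` of size `h` has area at least a constant times `h²`, so `|z₂|⁻²` is
not `σ`-integrable (`lintegral_eggSigma_eq_top`) and no pole survives for `σ`. The density of `ω_p`
is `2p |z₁|^(2p-2) |z₂|^(2p-2)` divided by the norm of the gradient (`dcWedgeDdc_eggExhaustion`),
which admits exactly the poles of order at most `p - 1`. Each new monomial enlarges the space,
because its distance to the previous one is at least its own norm (`hardySpace_ssubset_succ`).

For claim 3, multiplication by `z₂` maps the space of order `k + 1` injectively into that of order
`k`. If it were onto, the open mapping theorem would give `‖f‖ ≤ C ‖z₂ f‖`. High powers of `z₁`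
concentrate near `{z₂ = 0}` and violate this bound (`exists_integral_gt`, `not_surjOn_mulZ2`). -/

open Filter Topology UnitAddTorus

/-! ### Fourier series of continuous functions on the two-torus -/

/-- The two-dimensional torus of angles. -/
abbrev Torus2 : Type := UnitAddTorus (Fin 2)

/-- The normalized Haar measure of the torus. -/
noncomputable def torusMeasure : Measure Torus2 :=
  Measure.pi fun _ => AddCircle.haarAddCircle

instance : IsProbabilityMeasure torusMeasure := by
  unfold torusMeasure; infer_instance

theorem eLpNorm_two_sq {α : Type*} [MeasurableSpace α] (μ : Measure α) (f : α → ℂ) :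
    eLpNorm f 2 μ ^ 2 = ∫⁻ x, ‖f x‖ₑ ^ 2 ∂μ := by
  have h := eLpNorm_nnreal_pow_eq_lintegral (f := f) (μ := μ) (p := 2) (by norm_num)
  simpa using h

section TorusFourier

-- With normalized Haar measure as volume on the circle, `torusMeasure` is by definition the volume
-- on the torus to which `mFourierCoeff` and `mFourierLp` refer.
noncomputable local instance : MeasureSpace UnitAddCircle := ⟨AddCircle.haarAddCircle⟩

local instance : Measure.IsAddHaarMeasure (volume : Measure UnitAddCircle) :=
  inferInstanceAs (Measure.IsAddHaarMeasure AddCircle.haarAddCircle)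

local instance : IsProbabilityMeasure (volume : Measure UnitAddCircle) :=
  inferInstanceAs (IsProbabilityMeasure AddCircle.haarAddCircle)

theorem mFourierCoeff_eq_integral_torusMeasure (f : Torus2 → ℂ) (n : Fin 2 → ℤ) :
    mFourierCoeff f n = ∫ t, mFourier (-n) t * f t ∂torusMeasure := rfl

theorem lintegral_torusMeasure_sq (f : C(Torus2, ℂ)) :
    ∫⁻ t, ‖f t‖ₑ ^ 2 ∂torusMeasure =
      ‖ContinuousMap.toLp (E := ℂ) 2 (volume : Measure Torus2) ℂ f‖ₑ ^ 2 := by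
  rw [Lp.enorm_def, eLpNorm_congr_ae (ContinuousMap.coeFn_toLp volume f),
    eLpNorm_two_sq]
  rfl

theorem toLp_sub_partialSum (f : C(Torus2, ℂ)) (S : Finset (Fin 2 → ℤ)) :
    ContinuousMap.toLp (E := ℂ) 2 (volume : Measure Torus2) ℂ
      (f - ∑ n ∈ S, mFourierCoeff f n • mFourier n) =
    ContinuousMap.toLp (E := ℂ) 2 (volume : Measure Torus2) ℂ f -
      ∑ n ∈ S, mFourierCoeff f n • mFourierLp 2 n := by
  simp [map_sub, map_sum, map_smul]

theorem inner_mFourierLp_toLp (f : C(Torus2, ℂ)) (n : Fin 2 → ℤ) :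
    inner ℂ (mFourierLp 2 n) (ContinuousMap.toLp (E := ℂ) 2 (volume : Measure Torus2) ℂ f) =
      mFourierCoeff f n := by
  rw [← mFourierCoeff_toLp, ← mFourierBasis_repr, HilbertBasis.repr_apply_apply,
    coe_mFourierBasis]

theorem lintegral_sub_partialSum_eq (f : C(Torus2, ℂ)) (S : Finset (Fin 2 → ℤ)) :
    ∫⁻ t, ‖f t - ∑ n ∈ S, mFourierCoeff f n * mFourier n t‖ₑ ^ 2 ∂torusMeasure =
      ‖ContinuousMap.toLp (E := ℂ) 2 (volume : Measure Torus2) ℂ f -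
      ∑ n ∈ S, mFourierCoeff f n • mFourierLp 2 n‖ₑ ^ 2 := by
  rw [← toLp_sub_partialSum, ← lintegral_torusMeasure_sq]
  simp

/-- The Fourier series of a continuous function on the torus converges in mean square. -/
theorem tendsto_lintegral_sub_partialSum (f : C(Torus2, ℂ)) :
    Tendsto (fun S : Finset (Fin 2 → ℤ) =>
      ∫⁻ t, ‖f t - ∑ n ∈ S, mFourierCoeff f n * mFourier n t‖ₑ ^ 2 ∂torusMeasure)
      atTop (𝓝 0) := by
  have h := hasSum_mFourier_series_L2 (ContinuousMap.toLp (E := ℂ) 2 (volume : Measure Torus2) ℂ f)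
  simp only [mFourierCoeff_toLp] at h
  simp only [lintegral_sub_partialSum_eq]
  have h2 := (tendsto_const_nhds (x := ContinuousMap.toLp (E := ℂ) 2
    (volume : Measure Torus2) ℂ f)).sub h
  have h3 := (ENNReal.continuous_pow 2).tendsto _ |>.comp (continuous_enorm.tendsto _ |>.comp h2)
  simpa [Function.comp_def] using h3

/-- The partial sum is an orthogonal projection, so `‖f - Pf‖² = ‖f‖² - ‖Pf‖²`. The bound is uniform
in `S` and later serves as the domination over the orbits. -/
theorem lintegral_sub_partialSum_le (f : C(Torus2, ℂ)) (S : Finset (Fin 2 → ℤ)) :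
    ∫⁻ t, ‖f t - ∑ n ∈ S, mFourierCoeff f n * mFourier n t‖ₑ ^ 2 ∂torusMeasure ≤
      ∫⁻ t, ‖f t‖ₑ ^ 2 ∂torusMeasure := by
  rw [lintegral_sub_partialSum_eq, lintegral_torusMeasure_sq]
  gcongr
  rw [enorm_le_iff_norm_le, ← sq_le_sq₀ (norm_nonneg _) (norm_nonneg _), @norm_sub_sq ℂ]
  set F := ContinuousMap.toLp (E := ℂ) 2 (volume : Measure Torus2) ℂ f
  have h1 : inner ℂ F (∑ n ∈ S, mFourierCoeff f n • mFourierLp 2 n) =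
      ∑ n ∈ S, ((‖mFourierCoeff f n‖ ^ 2 : ℝ) : ℂ) := by
    rw [inner_sum]
    refine Finset.sum_congr rfl fun n _ => ?_
    rw [inner_smul_right, ← inner_conj_symm, inner_mFourierLp_toLp, Complex.mul_conj']
    norm_cast
  have h2 : ((‖∑ n ∈ S, mFourierCoeff f n • mFourierLp 2 n‖ ^ 2 : ℝ) : ℂ) =
      ∑ n ∈ S, ((‖mFourierCoeff f n‖ ^ 2 : ℝ) : ℂ) := by
    have := inner_self_eq_norm_sq_to_K (𝕜 := ℂ)
      (∑ n ∈ S, mFourierCoeff f n • mFourierLp (d := Fin 2) 2 n)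
    push_cast
    rw [orthonormal_mFourier.inner_sum] at this
    refine this.symm.trans ?_
    refine Finset.sum_congr rfl fun n _ => ?_
    rw [mul_comm, Complex.mul_conj']
  rw [h1]
  have h3 : ‖∑ n ∈ S, mFourierCoeff f n • mFourierLp 2 n‖ ^ 2 =
    ∑ n ∈ S, ‖mFourierCoeff f n‖ ^ 2 := by exact_mod_cast h2
  rw [h3]
  have h4 : RCLike.re (∑ n ∈ S, ((‖mFourierCoeff f n‖ ^ 2 : ℝ) : ℂ)) =
    ∑ n ∈ S, ‖mFourierCoeff f n‖ ^ 2 := by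
    rw [← Complex.ofReal_sum]; exact Complex.ofReal_re _
  rw [h4]
  have : 0 ≤ ∑ n ∈ S, ‖mFourierCoeff f n‖ ^ 2 := by positivity
  linarith

/-- Cauchy–Schwarz against the unit vector `mFourierLp 2 n`. -/
theorem enorm_mFourierCoeff_sq_le (f : C(Torus2, ℂ)) (n : Fin 2 → ℤ) :
    ‖mFourierCoeff f n‖ₑ ^ 2 ≤ ∫⁻ t, ‖f t‖ₑ ^ 2 ∂torusMeasure := by
  rw [lintegral_torusMeasure_sq]
  gcongr
  rw [enorm_le_iff_norm_le, ← inner_mFourierLp_toLp]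
  refine (norm_inner_le_norm _ _).trans ?_
  rw [orthonormal_mFourier.1 n, one_mul]

end TorusFourier

/-! ### Holomorphic functions on circles -/

theorem exists_fourier_mul_eq {z w : ℂ} (h : ‖w‖ = ‖z‖) :
    ∃ s : UnitAddCircle, w = fourier 1 s * z := by
  by_cases hz : z = 0
  · subst hz
    exact ⟨0, by simpa using h⟩
  refine ⟨((Complex.arg (w / z) / (2 * Real.pi) : ℝ) : UnitAddCircle), ?_⟩
  have h1 : ‖w / z‖ = 1 := by rw [norm_div, h, div_self (norm_ne_zero_iff.2 hz)]
  have h2 := Complex.norm_mul_exp_arg_mul_I (w / z)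
  rw [h1] at h2
  rw [fourier_coe_apply]
  have h3 : 2 * (Real.pi : ℂ) * Complex.I * ((1 : ℤ) : ℂ) *
      ((Complex.arg (w / z) / (2 * Real.pi) : ℝ) : ℂ) / ((1 : ℝ) : ℂ) =
      Complex.arg (w / z) * Complex.I := by
    have hπ : (Real.pi : ℂ) ≠ 0 := by exact_mod_cast Real.pi_ne_zero
    push_cast
    field_simp
  rw [h3]
  have h4 : Complex.exp (Complex.arg (w / z) * Complex.I) = w / z := by simpa using h2
  rw [h4]
  field_simp

/-- The average of a function over the circle through `w` as a circle integral. -/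
theorem integral_haarAddCircle_eq_circleIntegral (φ : ℂ → ℂ) {w : ℂ} (hw : w ≠ 0) :
    ∫ t : UnitAddCircle, φ (fourier 1 t * w) ∂AddCircle.haarAddCircle =
      (2 * Real.pi * Complex.I : ℂ)⁻¹ * ∮ z in C(0, ‖w‖), z⁻¹ * φ z := by
  obtain ⟨s, hs⟩ : ∃ s : UnitAddCircle, w = fourier 1 s * ‖w‖ :=
    exists_fourier_mul_eq (by simp)
  have h1 : ∫ t : UnitAddCircle, φ (fourier 1 t * w) ∂AddCircle.haarAddCircle =
      ∫ t : UnitAddCircle, φ (fourier 1 t * ‖w‖) ∂AddCircle.haarAddCircle := by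
    rw [← integral_add_right_eq_self (fun t : UnitAddCircle => φ (fourier 1 t * ‖w‖)) s]
    congr 1
    ext t
    congr 1
    conv_lhs => rw [hs]
    simp only [fourier_one, AddCircle.toCircle_add, Circle.coe_mul]
    ring
  have h2 : (AddCircle.haarAddCircle : Measure UnitAddCircle) = volume := by
    rw [AddCircle.volume_eq_smul_haarAddCircle]; simp
  have hπ : (Real.pi : ℂ) ≠ 0 := by exact_mod_cast Real.pi_ne_zero
  rw [h1, h2, ← UnitAddCircle.intervalIntegral_preimage 0]
  have h3 : ∀ x : ℝ, φ (fourier 1 (x : UnitAddCircle) * ‖w‖) =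
      (fun θ : ℝ => φ (circleMap 0 ‖w‖ θ)) (2 * Real.pi * x) := by
    intro x
    simp only [fourier_coe_apply, circleMap]
    congr 1
    rw [zero_add, mul_comm]
    congr 2
    push_cast
    ring
  simp_rw [h3]
  rw [intervalIntegral.integral_comp_mul_left (fun θ : ℝ => φ (circleMap 0 ‖w‖ θ))
    (by positivity), circleIntegral]
  simp only [mul_zero, zero_add, mul_one, deriv_circleMap, smul_eq_mul]
  have h4 : ∀ θ : ℝ, circleMap 0 ‖w‖ θ * Complex.I *
      ((circleMap 0 ‖w‖ θ)⁻¹ * φ (circleMap 0 ‖w‖ θ)) = Complex.I * φ (circleMap 0 ‖w‖ θ) := by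
    intro θ
    have : circleMap 0 ‖w‖ θ ≠ 0 := circleMap_ne_center (norm_ne_zero_iff.2 hw)
    field_simp
  simp_rw [h4]
  rw [intervalIntegral.integral_const_mul, Complex.real_smul]
  push_cast
  field_simp

/-- The coefficient of order `a : ℤ` of the Laurent series at `0` of a holomorphic function. -/
noncomputable def laurentCoeff (g : ℂ → ℂ) : ℤ → ℂ
  | Int.ofNat n => (n.factorial : ℂ)⁻¹ * iteratedDeriv n g 0
  | Int.negSucc _ => 0

theorem laurentCoeff_of_neg (g : ℂ → ℂ) {a : ℤ} (ha : a < 0) : laurentCoeff g a = 0 := by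
  cases a with
  | ofNat n => exact absurd ha (by simp)
  | negSucc n => rfl

theorem fourier_one_zpow (n : ℤ) (t : UnitAddCircle) : (fourier 1 t : ℂ) ^ n = fourier n t := by
  rw [fourier_one, fourier_apply, AddCircle.toCircle_zsmul, Circle.coe_zpow]

/-- The Fourier coefficients of the restriction of a holomorphic function to a circle. -/
theorem integral_fourier_mul_circle {g : ℂ → ℂ} {w : ℂ} (hw : w ≠ 0)
    (hg : DiffContOnCl ℂ g (Metric.ball 0 ‖w‖)) (a : ℤ) :
    ∫ t : UnitAddCircle, fourier (-a) t * g (fourier 1 t * w) ∂AddCircle.haarAddCircle =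
      w ^ a * laurentCoeff g a := by
  have h1 : ∀ t : UnitAddCircle, fourier (-a) t * g (fourier 1 t * w) =
      (fun z => (w / z) ^ a * g z) (fourier 1 t * w) := by
    intro t
    have : (fourier 1 t : ℂ) ≠ 0 := by simp
    have h : w / (fourier 1 t * w) = (fourier 1 t : ℂ)⁻¹ := by field_simp
    simp only [h, inv_zpow', fourier_one_zpow]
  simp_rw [h1]
  rw [integral_haarAddCircle_eq_circleIntegral (fun z => (w / z) ^ a * g z) hw]
  cases a with
  -- For a nonnegative index the circle integral is a term of the Cauchy power series.
  | ofNat n =>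
    have hR : 0 < ‖w‖₊ := nnnorm_pos.2 hw
    have h2 := DiffContOnCl.hasFPowerSeriesOnBall (R := ‖w‖₊) hg hR
    have h3 := h2.factorial_smul (y := w) n
    rw [cauchyPowerSeries_apply] at h3
    have h4 : iteratedFDeriv ℂ n g 0 (fun _ => w) = w ^ n * iteratedDeriv n g 0 := by
      rw [iteratedFDeriv_apply_eq_iteratedDeriv_mul_prod]; simp
    rw [h4] at h3
    simp only [sub_zero, smul_eq_mul, coe_nnnorm, nsmul_eq_mul] at h3
    simp only [laurentCoeff, Int.ofNat_eq_natCast, zpow_natCast]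
    have hf : (n.factorial : ℂ) ≠ 0 := by exact_mod_cast n.factorial_ne_zero
    rw [mul_left_comm, ← h3, inv_mul_cancel_left₀ hf]
    congr 2
    ext z
    ring
  | negSucc n =>
    simp only [laurentCoeff, mul_zero]
    -- For a negative index the pole cancels: the integrand is a constant times `z ^ n * g z`, and
    -- Cauchy's theorem applies.
    have h2 : (∮ z in C(0, ‖w‖), z⁻¹ * ((w / z) ^ (Int.negSucc n) * g z)) =
        ∮ z in C(0, ‖w‖), (w ^ (n + 1))⁻¹ * (z ^ n * g z) := by
      refine circleIntegral.integral_congr (norm_nonneg _) fun z hz => ?_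
      have hz0 : z ≠ 0 := by
        rintro rfl
        simp only [mem_sphere_iff_norm, sub_self, norm_zero] at hz
        exact hw (norm_eq_zero.1 hz.symm)
      simp only [zpow_negSucc, div_pow]
      field_simp
      ring
    rw [h2]
    rw [DiffContOnCl.circleIntegral_eq_zero (norm_nonneg _), mul_zero]
    refine DiffContOnCl.smul (c := fun _ => (w ^ (n + 1))⁻¹) diffContOnCl_const ?_
    exact DiffContOnCl.smul (c := fun z => z ^ n)
      (Differentiable.diffContOnCl (by fun_prop)) hg

/-! ### Torus orbits and the monomial form of Fourier coefficients -/

/-- The diagonal action of the torus on `ℂ²`. -/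
noncomputable def torusRot (t : Torus2) (z : C2) : C2 :=
  !₂[fourier 1 (t 0) * z 0, fourier 1 (t 1) * z 1]

@[simp]
theorem torusRot_apply_zero (t : Torus2) (z : C2) : torusRot t z 0 = fourier 1 (t 0) * z 0 := rfl

@[simp]
theorem torusRot_apply_one (t : Torus2) (z : C2) : torusRot t z 1 = fourier 1 (t 1) * z 1 := rfl

theorem norm_fourier_apply (n : ℤ) (t : UnitAddCircle) : ‖(fourier n t : ℂ)‖ = 1 := by
  rw [fourier_apply]; exact Circle.norm_coe _

theorem continuous_torusRot_prod : Continuous fun q : Torus2 × C2 => torusRot q.1 q.2 := by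
  unfold torusRot
  refine (PiLp.continuous_toLp 2 _).comp (continuous_pi fun i => ?_)
  fin_cases i
  · exact ((fourier 1).continuous.comp (by fun_prop)).mul (by fun_prop)
  · exact ((fourier 1).continuous.comp (by fun_prop)).mul (by fun_prop)

theorem continuous_torusRot_left (z : C2) : Continuous fun t : Torus2 => torusRot t z :=
  continuous_torusRot_prod.comp (by fun_prop : Continuous fun t : Torus2 => (t, z))

/-- Both orders of integration are recorded because Cauchy's formula is applied with either variable
as the inner one. -/
theorem integral_torusMeasure_eq (f : C(Torus2, ℂ)) :
    ∫ t, f t ∂torusMeasure =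
      ∫ u, ∫ s, f ![s, u] ∂AddCircle.haarAddCircle ∂AddCircle.haarAddCircle ∧
    ∫ t, f t ∂torusMeasure =
      ∫ s, ∫ u, f ![s, u] ∂AddCircle.haarAddCircle ∂AddCircle.haarAddCircle := by
  have hmp := (measurePreserving_finTwoArrow
    (AddCircle.haarAddCircle : Measure UnitAddCircle)).symm
  have h1 : ∫ t, f t ∂torusMeasure = ∫ q : UnitAddCircle × UnitAddCircle, f ![q.1, q.2]
      ∂(AddCircle.haarAddCircle.prod AddCircle.haarAddCircle) :=
    (hmp.integral_comp' (g := fun t => f t)).symm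
  have hc : Continuous fun q : UnitAddCircle × UnitAddCircle => f ![q.1, q.2] :=
    f.continuous.comp (by fun_prop)
  have hi : Integrable (fun q : UnitAddCircle × UnitAddCircle => f ![q.1, q.2])
      (AddCircle.haarAddCircle.prod AddCircle.haarAddCircle) :=
    hc.integrable_of_hasCompactSupport (HasCompactSupport.of_compactSpace _)
  exact ⟨h1.trans (integral_prod_symm _ hi), h1.trans (integral_prod _ hi)⟩

/-- A set of points of the boundary of the egg which is invariant under the torus. -/
structure IsReinhardtBoundary (p : ℕ) (T : Set C2) : Prop where
  norm_eq : ∀ z ∈ T, ‖z 0‖ ^ (2 * p) + ‖z 1‖ ^ (2 * p) = 1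
  torusRot_mem : ∀ z ∈ T, ∀ t, torusRot t z ∈ T

theorem torusRot_mem_egg {p : ℕ} {z : C2} (hz : z ∈ egg p) (t : Torus2) :
    torusRot t z ∈ egg p := by
  change ‖fourier 1 (t 0) * z 0‖ ^ (2 * p) + ‖fourier 1 (t 1) * z 1‖ ^ (2 * p) < 1
  rw [norm_mul, norm_mul, norm_fourier_apply, norm_fourier_apply, one_mul, one_mul]
  exact hz

namespace IsReinhardtBoundary

variable {p : ℕ} {T : Set C2} (hT : IsReinhardtBoundary p T)
include hT

theorem torusRot_mem_union {z : C2} (hz : z ∈ egg p ∪ T) (t : Torus2) :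
    torusRot t z ∈ egg p ∪ T :=
  hz.imp (fun h => torusRot_mem_egg h t) (fun h => hT.torusRot_mem z h t)

theorem norm_le {z : C2} (hz : z ∈ egg p ∪ T) : ‖z 0‖ ^ (2 * p) + ‖z 1‖ ^ (2 * p) ≤ 1 :=
  hz.elim (fun h => le_of_lt h) (fun h => (hT.norm_eq z h).le)

theorem continuous_comp_torusRot {G : C2 → ℂ} (hG : ContinuousOn G (egg p ∪ T)) {z : C2}
    (hz : z ∈ egg p ∪ T) : Continuous fun t => G (torusRot t z) :=
  hG.comp_continuous (continuous_torusRot_left z) fun t => hT.torusRot_mem_union hz t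

/-- The open disc obtained by shrinking the first coordinate lies in the egg, and its bounding
circle lies in the torus orbit of `z`. Hence continuity on the egg and on an invariant set `T`
suffices, and `T` need not be the whole boundary. -/
theorem diffContOnCl_fst (hp : 1 ≤ p) {G : C2 → ℂ} (hd : DifferentiableOn ℂ G (egg p))
    (hG : ContinuousOn G (egg p ∪ T)) {z : C2} (hz : z ∈ egg p ∪ T) (h0 : z 0 ≠ 0) :
    DiffContOnCl ℂ (fun w => G !₂[w, z 1]) (Metric.ball 0 ‖z 0‖) := by
  have hmem : ∀ w ∈ Metric.ball (0 : ℂ) ‖z 0‖, !₂[w, z 1] ∈ egg p := by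
    intro w hw
    rw [mem_ball_zero_iff] at hw
    have := hT.norm_le hz
    have h2 : ‖w‖ ^ (2 * p) < ‖z 0‖ ^ (2 * p) := pow_lt_pow_left₀ hw (norm_nonneg _) (by omega)
    change ‖w‖ ^ (2 * p) + ‖z 1‖ ^ (2 * p) < 1
    linarith
  have hmem' : ∀ w ∈ Metric.closedBall (0 : ℂ) ‖z 0‖, !₂[w, z 1] ∈ egg p ∪ T := by
    intro w hw
    rw [mem_closedBall_zero_iff] at hw
    rcases hw.lt_or_eq with h | h
    · exact Or.inl (hmem w (by simpa using h))
    · obtain ⟨s, hs⟩ := exists_fourier_mul_eq h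
      convert hT.torusRot_mem_union hz ![s, 0] using 1
      ext i
      fin_cases i
      · exact hs
      · simp
  have hdiff : Differentiable ℂ fun w : ℂ => (!₂[w, z 1] : C2) := by
    rw [differentiable_euclidean]
    intro i
    fin_cases i
    · exact differentiable_id
    · exact differentiable_const _
  refine ⟨hd.comp hdiff.differentiableOn hmem, ?_⟩
  rw [closure_ball _ (norm_ne_zero_iff.2 h0)]
  exact hG.comp hdiff.continuous.continuousOn hmem'

theorem diffContOnCl_snd (hp : 1 ≤ p) {G : C2 → ℂ} (hd : DifferentiableOn ℂ G (egg p))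
    (hG : ContinuousOn G (egg p ∪ T)) {z : C2} (hz : z ∈ egg p ∪ T) (h1 : z 1 ≠ 0) :
    DiffContOnCl ℂ (fun w => G !₂[z 0, w]) (Metric.ball 0 ‖z 1‖) := by
  have hmem : ∀ w ∈ Metric.ball (0 : ℂ) ‖z 1‖, !₂[z 0, w] ∈ egg p := by
    intro w hw
    rw [mem_ball_zero_iff] at hw
    have := hT.norm_le hz
    have h2 : ‖w‖ ^ (2 * p) < ‖z 1‖ ^ (2 * p) := pow_lt_pow_left₀ hw (norm_nonneg _) (by omega)
    change ‖z 0‖ ^ (2 * p) + ‖w‖ ^ (2 * p) < 1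
    linarith
  have hmem' : ∀ w ∈ Metric.closedBall (0 : ℂ) ‖z 1‖, !₂[z 0, w] ∈ egg p ∪ T := by
    intro w hw
    rw [mem_closedBall_zero_iff] at hw
    rcases hw.lt_or_eq with h | h
    · exact Or.inl (hmem w (by simpa using h))
    · obtain ⟨s, hs⟩ := exists_fourier_mul_eq h
      convert hT.torusRot_mem_union hz ![0, s] using 1
      ext i
      fin_cases i
      · simp
      · exact hs
  have hdiff : Differentiable ℂ fun w : ℂ => (!₂[z 0, w] : C2) := by
    rw [differentiable_euclidean]
    intro i
    fin_cases i
    · exact differentiable_const _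
    · exact differentiable_id
  refine ⟨hd.comp hdiff.differentiableOn hmem, ?_⟩
  rw [closure_ball _ (norm_ne_zero_iff.2 h1)]
  exact hG.comp hdiff.continuous.continuousOn hmem'

/-- The first expression isolates the dependence on `z 0`, the second that on `z 1`. Comparing them
forces a monomial. -/
theorem mFourierCoeff_comp_torusRot (hp : 1 ≤ p) {G : C2 → ℂ}
    (hd : DifferentiableOn ℂ G (egg p)) (hG : ContinuousOn G (egg p ∪ T)) {z : C2}
    (hz : z ∈ egg p ∪ T) (h0 : z 0 ≠ 0) (h1 : z 1 ≠ 0) (n : Fin 2 → ℤ) :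
    mFourierCoeff (fun t => G (torusRot t z)) n = z 0 ^ n 0 *
      ∫ u : UnitAddCircle, fourier (-n 1) u * laurentCoeff (fun w => G !₂[w, fourier 1 u * z 1]) (n 0)
        ∂AddCircle.haarAddCircle ∧
    mFourierCoeff (fun t => G (torusRot t z)) n = z 1 ^ n 1 *
      ∫ s : UnitAddCircle, fourier (-n 0) s * laurentCoeff (fun w => G !₂[fourier 1 s * z 0, w]) (n 1)
        ∂AddCircle.haarAddCircle := by
  let f : C(Torus2, ℂ) := mFourier (-n) * ⟨_, hT.continuous_comp_torusRot hG hz⟩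
  have hf : ∀ s u, f ![s, u] = fourier (-n 1) u * (fourier (-n 0) s *
      G !₂[fourier 1 s * z 0, fourier 1 u * z 1]) := by
    intro s u
    simp only [f, ContinuousMap.mul_apply, mFourier, ContinuousMap.coe_mk, Fin.prod_univ_two]
    simp only [Pi.neg_apply, Matrix.cons_val_zero, Matrix.cons_val_one]
    rw [show torusRot ![s, u] z = !₂[fourier 1 s * z 0, fourier 1 u * z 1] from rfl]
    ring
  obtain ⟨e1, e2⟩ := integral_torusMeasure_eq f
  constructor
  · refine e1.trans ?_
    rw [← integral_const_mul]
    refine integral_congr_ae (ae_of_all _ fun u => ?_)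
    simp only [hf]
    rw [integral_const_mul]
    have hu := hT.diffContOnCl_fst hp hd hG (hT.torusRot_mem_union hz ![0, u])
      (by simpa using h0)
    rw [integral_fourier_mul_circle h0 (g := fun w => G !₂[w, fourier 1 u * z 1])
      (by simpa using hu) (n 0)]
    ring
  · refine e2.trans ?_
    rw [← integral_const_mul]
    refine integral_congr_ae (ae_of_all _ fun s => ?_)
    simp only [hf, mul_left_comm (fourier (-n 1) (_ : UnitAddCircle) : ℂ)]
    rw [integral_const_mul]
    have hs := hT.diffContOnCl_snd hp hd hG (hT.torusRot_mem_union hz ![s, 0])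
      (by simpa using h1)
    rw [integral_fourier_mul_circle h1 (g := fun w => G !₂[fourier 1 s * z 0, w])
      (by simpa using hs) (n 1)]
    ring

/-- The torus components of a holomorphic function are monomials. -/
theorem exists_coeff (hp : 1 ≤ p) {G : C2 → ℂ}
    (hd : DifferentiableOn ℂ G (egg p)) (hG : ContinuousOn G (egg p ∪ T)) :
    ∃ C : (Fin 2 → ℤ) → ℂ, (∀ n, n 0 < 0 ∨ n 1 < 0 → C n = 0) ∧
      ∀ z ∈ egg p ∪ T, z 0 ≠ 0 → z 1 ≠ 0 → ∀ n,
        mFourierCoeff (fun t => G (torusRot t z)) n = C n * (z 0 ^ n 0 * z 1 ^ n 1) := by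
  -- `B` depends on the first coordinate only and `A` on the second only, so `z 0 ^ n 0 * A n (z 1)
  -- = z 1 ^ n 1 * B n (z 0)` separates the variables.
  let B : (Fin 2 → ℤ) → ℂ → ℂ := fun n x =>
    ∫ s : UnitAddCircle, fourier (-n 0) s * laurentCoeff (fun w => G !₂[fourier 1 s * x, w]) (n 1)
        ∂AddCircle.haarAddCircle
  let A : (Fin 2 → ℤ) → ℂ → ℂ := fun n y =>
    ∫ u : UnitAddCircle, fourier (-n 1) u * laurentCoeff (fun w => G !₂[w, fourier 1 u * y]) (n 0)
        ∂AddCircle.haarAddCircle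
  have key := fun {z : C2} (hz : z ∈ egg p ∪ T) (h0 : z 0 ≠ 0) (h1 : z 1 ≠ 0) n =>
    hT.mFourierCoeff_comp_torusRot hp hd hG hz h0 h1 n
  have hfst : ∀ {z : C2}, z ∈ egg p ∪ T → ∀ w : ℂ, ‖w‖ < ‖z 0‖ → !₂[w, z 1] ∈ egg p ∪ T := by
    intro z hz w hw
    have := hT.norm_le hz
    have h2 : ‖w‖ ^ (2 * p) < ‖z 0‖ ^ (2 * p) := pow_lt_pow_left₀ hw (norm_nonneg _) (by omega)
    refine Or.inl ?_
    change ‖w‖ ^ (2 * p) + ‖z 1‖ ^ (2 * p) < 1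
    linarith
  have hh : (!₂[1 / 2, 1 / 2] : C2) ∈ egg p ∪ T := by
    refine Or.inl ?_
    change ‖(1 / 2 : ℂ)‖ ^ (2 * p) + ‖(1 / 2 : ℂ)‖ ^ (2 * p) < 1
    have h : ‖(1 / 2 : ℂ)‖ = 1 / 2 := by norm_num
    have h2 : (1 / 2 : ℝ) ^ (2 * p) ≤ (1 / 2) ^ 2 :=
      pow_le_pow_of_le_one (by norm_num) (by norm_num) (by omega)
    rw [h]
    linarith
  have hhalf : (1 / 2 : ℂ) ≠ 0 := by norm_num
  refine ⟨fun n => A n (1 / 2) / (1 / 2) ^ n 1, ?_, ?_⟩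
  · rintro n (h | h)
    · simp [A, laurentCoeff_of_neg _ h]
    · have e := key hh hhalf hhalf n
      have e2 : (1 / 2 : ℂ) ^ n 0 * A n (1 / 2) = (1 / 2 : ℂ) ^ n 1 * B n (1 / 2) :=
        e.1.symm.trans e.2
      have e3 : B n (1 / 2) = 0 := by simp [B, laurentCoeff_of_neg _ h]
      rw [e3, mul_zero] at e2
      have := (mul_eq_zero.1 e2).resolve_left (zpow_ne_zero _ hhalf)
      change A n (1 / 2) / _ = 0
      rw [this, zero_div]
  · intro z hz h0 h1 n
    -- A first coordinate `w` this small pairs with both `z 1` and `1/2` inside the domain, so `B n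
    -- w` links `A n (z 1)` with `A n (1 / 2)`.
    obtain ⟨w, hw0, hw1, hw2⟩ : ∃ w : ℂ, w ≠ 0 ∧ ‖w‖ < ‖z 0‖ ∧ ‖w‖ < ‖(1 / 2 : ℂ)‖ := by
      have hpos : 0 < min ‖z 0‖ ‖(1 / 2 : ℂ)‖ := lt_min (norm_pos_iff.2 h0) (norm_pos_iff.2 hhalf)
      obtain ⟨r, hr0, hr⟩ := exists_between hpos
      refine ⟨(r : ℂ), by exact_mod_cast hr0.ne', ?_, ?_⟩ <;>
        rw [Complex.norm_real, Real.norm_of_nonneg hr0.le]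
      · exact hr.trans_le (min_le_left _ _)
      · exact hr.trans_le (min_le_right _ _)
    have e1 := key (hfst hz w hw1) hw0 h1 n
    have e2 := key (hfst hh w hw2) hw0 hhalf n
    have e1' : w ^ n 0 * A n (z 1) = z 1 ^ n 1 * B n w := e1.1.symm.trans e1.2
    have e2' : w ^ n 0 * A n (1 / 2) = (1 / 2) ^ n 1 * B n w := e2.1.symm.trans e2.2
    have e : A n (z 1) = z 1 ^ n 1 * (A n (1 / 2) / (1 / 2) ^ n 1) := by
      have hw' := zpow_ne_zero (n 0) hw0
      have hq := zpow_ne_zero (n 1) hhalf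
      apply mul_left_cancel₀ hw'
      rw [e1']
      have : B n w = w ^ n 0 * A n (1 / 2) / (1 / 2) ^ n 1 := by
        rw [e2', mul_div_cancel_left₀ _ hq]
      rw [this]
      ring
    rw [(key hz h0 h1 n).1]
    change z 0 ^ n 0 * A n (z 1) = _
    rw [e]
    ring

end IsReinhardtBoundary

/-! ### Function spaces and torus-invariant measures -/

/-- The functions with a pole of order at most `k` along `{ψ = 0}` as a submodule. -/
def holoContPoleSubmodule (Ω : Set C2) (ν : Measure C2) (ψ : C2 → ℂ) (k : ℕ) :
    Submodule ℂ (C2 → ℂ) where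
  carrier := holoContPole Ω ν ψ k
  add_mem' := by
    rintro F F' ⟨⟨G, hG, hFG⟩, h0, hm⟩ ⟨⟨G', hG', hFG'⟩, h0', hm'⟩
    refine ⟨⟨G + G', ⟨hG.1.add hG'.1, hG.2.add hG'.2⟩, fun z hz hψ => ?_⟩,
      fun z hz hψ => ?_, hm.add hm'⟩
    · simp [hFG z hz hψ, hFG' z hz hψ, mul_add]
    · simp [h0 z hz hψ, h0' z hz hψ]
  zero_mem' := ⟨⟨0, ⟨differentiableOn_const 0, continuousOn_const⟩, by simp⟩, by simp,
    MemLp.zero⟩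
  smul_mem' := by
    rintro c F ⟨⟨G, hG, hFG⟩, h0, hm⟩
    refine ⟨⟨c • G, ⟨hG.1.const_smul c, hG.2.const_smul c⟩, fun z hz hψ => ?_⟩,
      fun z hz hψ => ?_, hm.const_smul c⟩
    · simp [hFG z hz hψ, mul_left_comm]
    · simp [h0 z hz hψ]

/-- The boundary values of `holoContPole` as a submodule of `L²`. -/
def boundaryValues (Ω : Set C2) (ν : Measure C2) (ψ : C2 → ℂ) (k : ℕ) :
    Submodule ℂ (Lp ℂ 2 ν) where
  carrier := {f | ∃ F ∈ holoContPole Ω ν ψ k, f =ᵐ[ν] F}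
  add_mem' := by
    rintro f g ⟨F, hF, hf⟩ ⟨F', hF', hg⟩
    exact ⟨F + F', (holoContPoleSubmodule Ω ν ψ k).add_mem hF hF',
      (Lp.coeFn_add f g).trans (hf.add hg)⟩
  zero_mem' := ⟨0, (holoContPoleSubmodule Ω ν ψ k).zero_mem, Lp.coeFn_zero ℂ 2 ν⟩
  smul_mem' := by
    rintro c f ⟨F, hF, hf⟩
    exact ⟨c • F, (holoContPoleSubmodule Ω ν ψ k).smul_mem c hF,
      (Lp.coeFn_smul c f).trans (hf.const_smul c)⟩

theorem toLp_mem_boundaryValues {Ω : Set C2} {ν : Measure C2} {ψ : C2 → ℂ} {k : ℕ} {F : C2 → ℂ}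
    (hF : F ∈ holoContPole Ω ν ψ k) : hF.2.2.toLp F ∈ boundaryValues Ω ν ψ k :=
  ⟨F, hF, hF.2.2.coeFn_toLp⟩

/-- A torus-invariant finite measure on the boundary of the egg that does not charge the
coordinate axes. -/
structure IsEggMeasure (p : ℕ) (ν : Measure C2) : Prop where
  finite : IsFiniteMeasure ν
  ae_norm_eq : ∀ᵐ z ∂ν, ‖z 0‖ ^ (2 * p) + ‖z 1‖ ^ (2 * p) = 1
  measurePreserving_torusRot : ∀ t, MeasurePreserving (torusRot t) ν ν
  ae_fst_ne_zero : ∀ᵐ z ∂ν, z 0 ≠ 0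
  ae_snd_ne_zero : ∀ᵐ z ∂ν, z 1 ≠ 0

/-- The Laurent monomial with exponents `n`, extended by zero to `{z₂ = 0}`. -/
noncomputable def laurentMonomial (n : Fin 2 → ℤ) (z : C2) : ℂ :=
  if z 1 = 0 then 0 else z 0 ^ n 0 * z 1 ^ n 1

theorem laurentMonomial_of_ne {n : Fin 2 → ℤ} {z : C2} (hz : z 1 ≠ 0) :
    laurentMonomial n z = z 0 ^ n 0 * z 1 ^ n 1 := if_neg hz

theorem measurable_laurentMonomial (n : Fin 2 → ℤ) : Measurable (laurentMonomial n) := by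
  unfold laurentMonomial
  have h0 : Measurable fun z : C2 => z 0 := by fun_prop
  have h1 : Measurable fun z : C2 => z 1 := by fun_prop
  exact Measurable.ite (h1 (measurableSet_singleton 0)) measurable_const
    ((h0.pow_const (n 0)).mul (h1.pow_const (n 1)))

theorem laurentMonomial_torusRot (n : Fin 2 → ℤ) (t : Torus2) (z : C2) :
    laurentMonomial n (torusRot t z) = mFourier n t * laurentMonomial n z := by
  have h : (fourier 1 (t 1) : ℂ) ≠ 0 := by simp
  by_cases hz : z 1 = 0
  · have h' : torusRot t z 1 = 0 := by rw [torusRot_apply_one, hz, mul_zero]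
    simp only [laurentMonomial, if_pos hz, if_pos h', mul_zero]
  · have h' : torusRot t z 1 ≠ 0 := by rw [torusRot_apply_one]; exact mul_ne_zero h hz
    rw [laurentMonomial_of_ne hz, laurentMonomial_of_ne h', torusRot_apply_zero,
      torusRot_apply_one, mul_zpow, mul_zpow, fourier_one_zpow, fourier_one_zpow]
    simp only [mFourier, ContinuousMap.coe_mk, Fin.prod_univ_two]
    ring

/-- Monomials with a pole of order at most `k` belong to `holoContPole` when they are square
integrable. -/
theorem laurentMonomial_mem_holoContPole {Ω : Set C2} {ν : Measure C2} {k : ℕ} {n : Fin 2 → ℤ}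
    (h0 : 0 ≤ n 0) (h1 : -(k : ℤ) ≤ n 1) (hL : MemLp (laurentMonomial n) 2 ν) :
    laurentMonomial n ∈ holoContPole Ω ν z2 k := by
  have hd : Differentiable ℂ fun z : C2 => z 0 ^ (n 0).toNat * z 1 ^ (n 1 + k).toNat := by
    fun_prop
  refine ⟨⟨_, ⟨hd.differentiableOn, hd.continuous.continuousOn⟩, fun z _ hz => ?_⟩,
    fun z _ hz => if_pos hz, hL⟩
  have hz' : z 1 ≠ 0 := hz
  rw [laurentMonomial_of_ne hz', z2, ← zpow_natCast, ← zpow_natCast, ← zpow_natCast,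
    Int.toNat_of_nonneg h0, Int.toNat_of_nonneg (by omega), zpow_add₀ hz']
  have := zpow_ne_zero (k : ℤ) hz'
  field_simp

namespace IsEggMeasure

variable {p : ℕ} {ν : Measure C2} (hν : IsEggMeasure p ν)
include hν

theorem isReinhardtBoundary : IsReinhardtBoundary p ν.support where
  norm_eq := by
    have hc : IsClosed {z : C2 | ‖z 0‖ ^ (2 * p) + ‖z 1‖ ^ (2 * p) = 1} :=
      isClosed_eq (by fun_prop) continuous_const
    exact fun z hz => Measure.support_subset_of_isClosed hc hν.ae_norm_eq hz
  torusRot_mem := by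
    intro z hz t
    have hc : Continuous (torusRot t) :=
      continuous_torusRot_prod.comp (by fun_prop : Continuous fun z : C2 => (t, z))
    rw [Measure.support_eq_forall_isOpen] at hz ⊢
    intro u hu ho
    rw [← (hν.measurePreserving_torusRot t).measure_preimage ho.measurableSet.nullMeasurableSet]
    exact hz _ hu (ho.preimage hc)

/-- Square integrable functions are measurable only up to `ν`-null sets. Their pullbacks along the
action are measurable on the product because null sets pull back to sets all of whose slices over
the torus are null. -/
theorem quasiMeasurePreserving_torusRot :
    Measure.QuasiMeasurePreserving (fun q : C2 × Torus2 => torusRot q.2 q.1)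
      (ν.prod torusMeasure) ν := by
  have := hν.finite
  have hm : Measurable fun q : C2 × Torus2 => torusRot q.2 q.1 :=
    (continuous_torusRot_prod.comp continuous_swap).measurable
  refine ⟨hm, Measure.AbsolutelyContinuous.mk fun s hs h0 => ?_⟩
  rw [Measure.map_apply hm hs, Measure.prod_apply_symm (hm hs)]
  have : ∀ t : Torus2, ν ((fun z => (z, t)) ⁻¹' ((fun q : C2 × Torus2 => torusRot q.2 q.1) ⁻¹' s))
      = 0 := fun t => by
    have := (hν.measurePreserving_torusRot t).measure_preimage hs.nullMeasurableSet
    rw [h0] at this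
    exact this
  simp [this]

/-- Tonelli, then invariance under each rotation, and total mass one of the torus. -/
theorem lintegral_eq_lintegral_torusRot {Φ : C2 → ℝ≥0∞} (hΦ : AEMeasurable Φ ν) :
    ∫⁻ z, Φ z ∂ν = ∫⁻ z, ∫⁻ t, Φ (torusRot t z) ∂torusMeasure ∂ν := by
  have := hν.finite
  have h := hΦ.comp_quasiMeasurePreserving hν.quasiMeasurePreserving_torusRot
  rw [lintegral_lintegral_swap (f := fun z t => Φ (torusRot t z)) h]
  have h2 : ∀ t, ∫⁻ z, Φ (torusRot t z) ∂ν = ∫⁻ z, Φ z ∂ν := fun t =>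
    (lintegral_map' (by rwa [(hν.measurePreserving_torusRot t).map_eq])
      (hν.measurePreserving_torusRot t).measurable.aemeasurable).symm.trans
      (by rw [(hν.measurePreserving_torusRot t).map_eq])
  simp [h2]

theorem aemeasurable_lintegral_torusRot {Φ : C2 → ℝ≥0∞} (hΦ : AEMeasurable Φ ν) :
    AEMeasurable (fun z => ∫⁻ t, Φ (torusRot t z) ∂torusMeasure) ν :=
  (hΦ.comp_quasiMeasurePreserving hν.quasiMeasurePreserving_torusRot).lintegral_prod_right'

theorem ae_mem : ∀ᵐ z ∂ν, z ∈ ν.support ∧ z 0 ≠ 0 ∧ z 1 ≠ 0 := by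
  filter_upwards [Measure.support_mem_ae (μ := ν), hν.ae_fst_ne_zero, hν.ae_snd_ne_zero]
    with z h h0 h1 using ⟨h, h0, h1⟩

/-- The torus components of a holomorphic function with a pole along `{z₂ = 0}`. -/
theorem exists_coeff_of_mem_holoContPole (hp : 1 ≤ p) {k : ℕ} {F : C2 → ℂ}
    (hF : F ∈ holoContPole (egg p) ν z2 k) :
    ∃ C : (Fin 2 → ℤ) → ℂ, (∀ n, n 0 < 0 ∨ n 1 < -(k : ℤ) → C n = 0) ∧
      ∀ z ∈ ν.support, z 0 ≠ 0 → z 1 ≠ 0 → Continuous (fun t => F (torusRot t z)) ∧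
        ∀ n, mFourierCoeff (fun t => F (torusRot t z)) n = C n * laurentMonomial n z := by
  obtain ⟨⟨G, ⟨hd, hG⟩, hFG⟩, -, -⟩ := hF
  obtain ⟨C, hC0, hC⟩ := hν.isReinhardtBoundary.exists_coeff hp hd hG
  -- Dividing by `z₂ᵏ` shifts the second Fourier index by `k`, so the coefficient of `F` at `n` is
  -- that of `G` at `n + e`.
  let e : Fin 2 → ℤ := ![0, k]
  refine ⟨fun n => C (n + e), fun n hn => hC0 _ ?_, fun z hz h0 h1 => ?_⟩
  · refine hn.imp (fun h => ?_) (fun h => ?_)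
    · simpa [e] using h
    · simp [e]; omega
  · have hK : z ∈ egg p ∪ ν.support := Or.inr hz
    have hF' : (fun t => F (torusRot t z)) =
        fun t => (z 1 ^ k)⁻¹ * (mFourier (-e) t * G (torusRot t z)) := by
      ext t
      have ht : (fourier 1 (t 1) : ℂ) ≠ 0 := by simp
      have hne : z2 (torusRot t z) ≠ 0 := by
        rw [z2, torusRot_apply_one]; exact mul_ne_zero ht h1
      rw [hFG _ (hν.isReinhardtBoundary.torusRot_mem_union hK t) hne, z2, torusRot_apply_one,
        mul_pow, mul_inv, ← zpow_natCast (fourier 1 (t 1) : ℂ), ← zpow_neg, fourier_one_zpow]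
      have : (mFourier (-e) t : ℂ) = fourier (-(k : ℤ)) (t 1) := by
        simp only [mFourier, ContinuousMap.coe_mk, Fin.prod_univ_two]
        rw [show (-e) 0 = 0 by simp [e], show (-e) 1 = -(k : ℤ) by simp [e], fourier_zero, one_mul]
      rw [this]
      ring
    constructor
    · rw [hF']
      exact continuous_const.mul ((mFourier (-e)).continuous.mul
        (hν.isReinhardtBoundary.continuous_comp_torusRot hG hK))
    · intro n
      rw [hF', mFourierCoeff_eq_integral_torusMeasure]
      have h2 : ∀ t : Torus2, mFourier (-n) t * ((z 1 ^ k)⁻¹ * (mFourier (-e) t *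
          G (torusRot t z))) = (z 1 ^ k)⁻¹ * (mFourier (-(n + e)) t * G (torusRot t z)) := by
        intro t
        rw [neg_add, mFourier_add]
        ring
      simp_rw [h2]
      rw [integral_const_mul, ← mFourierCoeff_eq_integral_torusMeasure, hC z hK h0 h1,
        laurentMonomial_of_ne h1]
      have h3 : (n + e) 0 = n 0 := by simp [e]
      have h4 : (n + e) 1 = n 1 + k := by simp [e]
      rw [h3, h4, zpow_add₀ h1, zpow_natCast]
      have := pow_ne_zero k h1
      field_simp

end IsEggMeasure

/-! ### Stabilization and strict growth of the Hardy spaces -/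

theorem holoContPole_subset_succ {Ω : Set C2} {ν : Measure C2} (k : ℕ) :
    holoContPole Ω ν z2 k ⊆ holoContPole Ω ν z2 (k + 1) := by
  rintro F ⟨⟨G, hG, hFG⟩, h0, hm⟩
  have hd : Differentiable ℂ z2 := by unfold z2; fun_prop
  refine ⟨⟨z2 * G, ⟨hd.differentiableOn.mul hG.1, hd.continuous.continuousOn.mul hG.2⟩,
    fun z hz hψ => ?_⟩, h0, hm⟩
  rw [hFG z hz hψ, Pi.mul_apply, pow_succ]
  have := pow_ne_zero k hψ
  field_simp

theorem holoContPole_mono {Ω : Set C2} {ν : Measure C2} :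
    Monotone (holoContPole Ω ν z2) := monotone_nat_of_le_succ holoContPole_subset_succ

theorem hardySpace_mono {Ω : Set C2} {ν : Measure C2} :
    Monotone (hardySpace Ω ν z2) := fun _ _ h =>
  closure_mono fun _ ⟨F, hF, hf⟩ => ⟨F, holoContPole_mono h hF, hf⟩

namespace IsEggMeasure

variable {p : ℕ} {ν : Measure C2} (hν : IsEggMeasure p ν)
include hν

/-- The torus components of a function are bounded by the function in `L²`. -/
theorem eLpNorm_le_of_mFourierCoeff_eq {F g : C2 → ℂ} (hF : AEStronglyMeasurable F ν)
    {n : Fin 2 → ℤ} (hc : ∀ᵐ z ∂ν, Continuous fun t => F (torusRot t z))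
    (hn : ∀ᵐ z ∂ν, mFourierCoeff (fun t => F (torusRot t z)) n = g z) :
    eLpNorm g 2 ν ≤ eLpNorm F 2 ν := by
  have h : eLpNorm g 2 ν ^ 2 ≤ eLpNorm F 2 ν ^ 2 := by
    rw [eLpNorm_two_sq, eLpNorm_two_sq,
      hν.lintegral_eq_lintegral_torusRot (Φ := fun z => ‖F z‖ₑ ^ 2) (hF.enorm.pow_const 2)]
    refine lintegral_mono_ae ?_
    filter_upwards [hc, hn] with z h1 h2
    rw [← h2]
    exact enorm_mFourierCoeff_sq_le ⟨_, h1⟩ n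
  exact (ENNReal.pow_le_pow_left_iff two_ne_zero).1 h

/-- A function is the `L²` limit of the sums of its torus components. -/
theorem tendsto_eLpNorm_sub_partialSum {F : C2 → ℂ} (hF : MemLp F 2 ν)
    {C : (Fin 2 → ℤ) → ℂ} (hc : ∀ᵐ z ∂ν, Continuous (fun t => F (torusRot t z)) ∧
      ∀ n, mFourierCoeff (fun t => F (torusRot t z)) n = C n * laurentMonomial n z) :
    Tendsto (fun S : Finset (Fin 2 → ℤ) =>
      eLpNorm (fun z => F z - ∑ n ∈ S, C n * laurentMonomial n z) 2 ν ^ 2) atTop (𝓝 0) := by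
  have hmS : ∀ S : Finset (Fin 2 → ℤ),
      AEMeasurable (fun z => ‖F z - ∑ n ∈ S, C n * laurentMonomial n z‖ₑ ^ 2) ν := fun S =>
    ((hF.1.sub (Finset.measurable_sum S fun n _ =>
      (measurable_laurentMonomial n).const_mul (C n)).aestronglyMeasurable).enorm).pow_const 2
  have hm : AEMeasurable (fun z => ‖F z‖ₑ ^ 2) ν := hF.1.enorm.pow_const 2
  simp_rw [eLpNorm_two_sq, hν.lintegral_eq_lintegral_torusRot (hmS _)]
  have heq : ∀ᵐ z ∂ν, ∃ f : C(Torus2, ℂ), (∀ t, f t = F (torusRot t z)) ∧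
      ∀ S : Finset (Fin 2 → ℤ),
      ∫⁻ t, ‖F (torusRot t z) - ∑ n ∈ S, C n * laurentMonomial n (torusRot t z)‖ₑ ^ 2
        ∂torusMeasure =
      ∫⁻ t, ‖f t - ∑ n ∈ S, mFourierCoeff f n * mFourier n t‖ₑ ^ 2 ∂torusMeasure := by
    filter_upwards [hc] with z hz
    refine ⟨⟨_, hz.1⟩, fun t => rfl, fun S => ?_⟩
    simp only [ContinuousMap.coe_mk, hz.2, laurentMonomial_torusRot]
    refine lintegral_congr fun t => ?_
    congr 3
    refine Finset.sum_congr rfl fun n _ => by ring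
  -- Dominated convergence is applied along sequences of finite index sets. The orbit average of
  -- `‖F‖²` dominates by Bessel, and Parseval on almost every orbit gives the pointwise limit.
  refine tendsto_of_seq_tendsto fun x hx => ?_
  rw [← lintegral_zero (μ := ν)]
  refine tendsto_lintegral_of_dominated_convergence'
    (fun z => ∫⁻ t, ‖F (torusRot t z)‖ₑ ^ 2 ∂torusMeasure)
    (fun i => hν.aemeasurable_lintegral_torusRot (hmS (x i))) (fun i => ?_) ?_ ?_
  · filter_upwards [heq] with z hz
    obtain ⟨f, hf, hS⟩ := hz
    rw [hS (x i)]
    simp_rw [← hf]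
    exact lintegral_sub_partialSum_le f (x i)
  · rw [← hν.lintegral_eq_lintegral_torusRot hm, ← eLpNorm_two_sq]
    exact ENNReal.pow_ne_top hF.2.ne
  · filter_upwards [heq] with z hz
    obtain ⟨f, hf, hS⟩ := hz
    simp_rw [hS]
    exact (tendsto_lintegral_sub_partialSum f).comp hx

theorem ae_coeff {F : C2 → ℂ} {C : (Fin 2 → ℤ) → ℂ}
    (hC : ∀ z ∈ ν.support, z 0 ≠ 0 → z 1 ≠ 0 → Continuous (fun t => F (torusRot t z)) ∧
        ∀ n, mFourierCoeff (fun t => F (torusRot t z)) n = C n * laurentMonomial n z) :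
    ∀ᵐ z ∂ν, Continuous (fun t => F (torusRot t z)) ∧
      ∀ n, mFourierCoeff (fun t => F (torusRot t z)) n = C n * laurentMonomial n z := by
  filter_upwards [hν.ae_mem] with z hz using hC z hz.1 hz.2.1 hz.2.2

/-- The chain of Hardy spaces is constant from the order at which monomials with poles fail to be
square integrable. -/
theorem hardySpace_eq_of_not_memLp (hp : 1 ≤ p) {m : ℕ}
    (hm : ∀ n : Fin 2 → ℤ, 0 ≤ n 0 → n 1 < -(m : ℤ) → ¬ MemLp (laurentMonomial n) 2 ν)
    {k : ℕ} (hk : m ≤ k) : hardySpace (egg p) ν z2 k = hardySpace (egg p) ν z2 m := by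
  refine Subset.antisymm (closure_minimal ?_ isClosed_closure) (hardySpace_mono hk)
  rintro f ⟨F, hF, hf⟩
  obtain ⟨C, hC0, hC⟩ := hν.exists_coeff_of_mem_holoContPole hp hF
  have hae := hν.ae_coeff hC
  have hterm : ∀ n, (C n) • laurentMonomial n ∈ holoContPoleSubmodule (egg p) ν z2 m := by
    intro n
    by_cases hCn : C n = 0
    · rw [hCn, zero_smul]; exact Submodule.zero_mem _
    -- A component of `F` inherits square integrability from `F`, so a nonzero coefficient forces
    -- the monomial itself into `L²`; by `hm` its pole then has order at most `m`.
    have hb : eLpNorm (C n • laurentMonomial n) 2 ν ≤ eLpNorm F 2 ν :=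
      hν.eLpNorm_le_of_mFourierCoeff_eq hF.2.2.1 (hae.mono fun z hz => hz.1)
        (hae.mono fun z hz => hz.2 n)
    have hL : MemLp (laurentMonomial n) 2 ν := by
      have h1 : MemLp (C n • laurentMonomial n) 2 ν :=
        ⟨((measurable_laurentMonomial n).const_smul (C n)).aestronglyMeasurable,
          hb.trans_lt hF.2.2.2⟩
      simpa [smul_smul, inv_mul_cancel₀ hCn] using h1.const_smul (C n)⁻¹
    have h0 : 0 ≤ n 0 := not_lt.1 fun h => hCn (hC0 n (Or.inl h))
    have h1 : -(m : ℤ) ≤ n 1 := not_lt.1 fun h => hm n h0 h hL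
    exact Submodule.smul_mem _ _ (laurentMonomial_mem_holoContPole h0 h1 hL)
  have hsum : ∀ S : Finset (Fin 2 → ℤ),
      (fun z => ∑ n ∈ S, C n * laurentMonomial n z) ∈ holoContPole (egg p) ν z2 m := by
    intro S
    have := Submodule.sum_mem (holoContPoleSubmodule (egg p) ν z2 m) (t := S)
      (fun n _ => hterm n)
    have he : ∑ n ∈ S, C n • laurentMonomial n = fun z => ∑ n ∈ S, C n * laurentMonomial n z := by
      ext z
      simp [Finset.sum_apply]
    rwa [he] at this
  have ht := hν.tendsto_eLpNorm_sub_partialSum hF.2.2 hae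
  refine mem_closure_of_tendsto (b := (atTop : Filter (Finset (Fin 2 → ℤ))))
    (f := fun S => (hsum S).2.2.toLp _) ?_
    (Eventually.of_forall fun S => toLp_mem_boundaryValues (hsum S))
  rw [tendsto_iff_edist_tendsto_0]
  have hsq : ∀ S : Finset (Fin 2 → ℤ), edist ((hsum S).2.2.toLp _) f =
      (eLpNorm (fun z => F z - ∑ n ∈ S, C n * laurentMonomial n z) 2 ν ^ 2) ^ (1 / 2 : ℝ) := by
    intro S
    rw [edist_comm, Lp.edist_def, ← ENNReal.rpow_natCast, ← ENNReal.rpow_mul]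
    norm_num
    refine eLpNorm_congr_ae ?_
    filter_upwards [hf, (hsum S).2.2.coeFn_toLp] with z h1 h2
    rw [Pi.sub_apply, h1, h2]
  simp_rw [hsq]
  have := (ENNReal.continuous_rpow_const (y := (1 / 2 : ℝ))).tendsto 0 |>.comp ht
  simpa [Function.comp_def] using this

/-- A square integrable pole of exact order `k + 1` enlarges the Hardy space. -/
theorem hardySpace_ssubset_succ (hp : 1 ≤ p) (h0 : ν ≠ 0) {k : ℕ}
    (hL : MemLp (laurentMonomial ![0, -((k : ℤ) + 1)]) 2 ν) :
    hardySpace (egg p) ν z2 k ⊂ hardySpace (egg p) ν z2 (k + 1) := by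
  refine ⟨hardySpace_mono (Nat.le_succ k), fun hsub => ?_⟩
  set n : Fin 2 → ℤ := ![0, -((k : ℤ) + 1)] with hn
  have hmem : laurentMonomial n ∈ holoContPole (egg p) ν z2 (k + 1) :=
    laurentMonomial_mem_holoContPole (by simp [hn]) (by simp [hn]) hL
  have hH : hL.toLp _ ∈ hardySpace (egg p) ν z2 k :=
    hsub (subset_closure (toLp_mem_boundaryValues hmem))
  -- All of the smaller space keeps distance at least `‖zⁿ‖` from `zⁿ`. This condition is closed,
  -- hence testable on boundary values, and it would make `zⁿ` zero if `zⁿ` belonged to the space.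
  have hclosed : IsClosed {f : Lp ℂ 2 ν | ‖hL.toLp _‖ₑ ≤ ‖f - hL.toLp _‖ₑ} :=
    isClosed_le continuous_const (by fun_prop)
  have hle : hardySpace (egg p) ν z2 k ⊆ {f : Lp ℂ 2 ν | ‖hL.toLp _‖ₑ ≤ ‖f - hL.toLp _‖ₑ} := by
    refine closure_minimal ?_ hclosed
    rintro f ⟨F, hF, hf⟩
    obtain ⟨C, hC0, hC⟩ := hν.exists_coeff_of_mem_holoContPole hp hF
    have hae := hν.ae_coeff hC
    have hCn : C n = 0 := hC0 n (Or.inr (by simp [hn]))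
    have hcm : ∀ z, Continuous fun t => laurentMonomial n (torusRot t z) := fun z => by
      simp_rw [laurentMonomial_torusRot]
      exact (mFourier n).continuous.mul continuous_const
    -- Since `C n = 0`, the `n`-th torus component of `F - zⁿ` is `-zⁿ`.
    have key := hν.eLpNorm_le_of_mFourierCoeff_eq (F := F - laurentMonomial n)
      (g := - laurentMonomial n) (n := n) (hF.2.2.1.sub hL.1)
      (hae.mono fun z hz => hz.1.sub (hcm z)) (hae.mono fun z hz => by
        have e := hz.2 n
        rw [hCn, zero_mul, mFourierCoeff_eq_integral_torusMeasure] at e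
        rw [mFourierCoeff_eq_integral_torusMeasure]
        simp only [Pi.sub_apply, mul_sub]
        have hi : ∀ f : Torus2 → ℂ, Continuous f → Integrable f torusMeasure := fun f hf =>
          hf.integrable_of_hasCompactSupport (HasCompactSupport.of_compactSpace _)
        rw [integral_sub (f := fun t => mFourier (-n) t * F (torusRot t z))
          (g := fun t => mFourier (-n) t * laurentMonomial n (torusRot t z))
          (hi _ ((mFourier (-n)).continuous.mul hz.1))
          (hi _ ((mFourier (-n)).continuous.mul (hcm z))), e]
        have : ∀ t : Torus2, mFourier (-n) t * laurentMonomial n (torusRot t z) =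
            laurentMonomial n z := fun t => by
          rw [laurentMonomial_torusRot, ← mul_assoc, ← mFourier_add]
          simp [mFourier_zero]
        simp [this])
    change ‖hL.toLp _‖ₑ ≤ ‖f - hL.toLp _‖ₑ
    rw [Lp.enorm_toLp, Lp.enorm_def]
    rw [eLpNorm_neg] at key
    refine key.trans_eq (eLpNorm_congr_ae ?_)
    filter_upwards [hf, hL.coeFn_toLp, Lp.coeFn_sub f (hL.toLp _)] with z h1 h2 h3
    rw [h3, Pi.sub_apply, Pi.sub_apply, h1, h2]
  have h1 := hle hH
  simp only [sub_self, mem_ofPred_eq, enorm_zero, nonpos_iff_eq_zero, Lp.enorm_toLp] at h1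
  rw [eLpNorm_eq_zero_iff hL.1 two_ne_zero] at h1
  apply h0
  have : ∀ᵐ z ∂ν, False := by
    filter_upwards [h1, hν.ae_mem] with z hz hm
    rw [laurentMonomial_of_ne hm.2.2] at hz
    exact mul_ne_zero (zpow_ne_zero _ hm.2.1) (zpow_ne_zero _ hm.2.2) hz
  simpa using this

end IsEggMeasure

/-! ### Multiplication by `z₂` -/

theorem aestronglyMeasurable_z2 (ν : Measure C2) : AEStronglyMeasurable z2 ν :=
  (by unfold z2; fun_prop : Continuous z2).aestronglyMeasurable

theorem memLp_z2_mul {ν : Measure C2} (hb : ∀ᵐ z ∂ν, ‖z2 z‖ ≤ 1) {F : C2 → ℂ}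
    (hF : MemLp F 2 ν) : MemLp (fun z => z2 z * F z) 2 ν := by
  refine hF.of_le ((aestronglyMeasurable_z2 ν).mul hF.1) ?_
  filter_upwards [hb] with z hz
  rw [norm_mul]
  exact mul_le_of_le_one_left (norm_nonneg _) hz

/-- Multiplication by `z₂` on `L²(ν)`, when `|z₂| ≤ 1` almost everywhere. -/
noncomputable def mulZ2 {ν : Measure C2} (hb : ∀ᵐ z ∂ν, ‖z2 z‖ ≤ 1) :
    Lp ℂ 2 ν →L[ℂ] Lp ℂ 2 ν :=
  LinearMap.mkContinuous
    { toFun := fun f => (memLp_z2_mul hb (Lp.memLp f)).toLp _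
      map_add' := fun f g => by
        apply Lp.ext
        filter_upwards [MemLp.coeFn_toLp (memLp_z2_mul hb (Lp.memLp (f + g))),
          MemLp.coeFn_toLp (memLp_z2_mul hb (Lp.memLp f)),
          MemLp.coeFn_toLp (memLp_z2_mul hb (Lp.memLp g)), Lp.coeFn_add f g,
          Lp.coeFn_add ((memLp_z2_mul hb (Lp.memLp f)).toLp _)
            ((memLp_z2_mul hb (Lp.memLp g)).toLp _)] with z h1 h2 h3 h4 h5
        rw [h1, h5, Pi.add_apply, h2, h3, h4, Pi.add_apply, mul_add]
      map_smul' := fun c f => by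
        apply Lp.ext
        filter_upwards [MemLp.coeFn_toLp (memLp_z2_mul hb (Lp.memLp (c • f))),
          MemLp.coeFn_toLp (memLp_z2_mul hb (Lp.memLp f)), Lp.coeFn_smul c f,
          Lp.coeFn_smul c ((memLp_z2_mul hb (Lp.memLp f)).toLp _)] with z h1 h2 h3 h4
        rw [h1, RingHom.id_apply, h4, Pi.smul_apply, h2, h3, Pi.smul_apply, smul_eq_mul,
          smul_eq_mul, mul_left_comm] }
    1 fun f => by
      rw [one_mul]
      refine Lp.norm_le_norm_of_ae_le ?_
      filter_upwards [MemLp.coeFn_toLp (memLp_z2_mul hb (Lp.memLp f)), hb] with z h1 h2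
      change ‖((memLp_z2_mul hb (Lp.memLp f)).toLp _ : C2 → ℂ) z‖ ≤ _
      rw [h1, norm_mul]
      exact mul_le_of_le_one_left (norm_nonneg _) h2

theorem coeFn_mulZ2 {ν : Measure C2} (hb : ∀ᵐ z ∂ν, ‖z2 z‖ ≤ 1) (f : Lp ℂ 2 ν) :
    mulZ2 hb f =ᵐ[ν] fun z => z2 z * f z :=
  MemLp.coeFn_toLp (memLp_z2_mul hb (Lp.memLp f))

theorem coeFn_mulZ2_iterate {ν : Measure C2} (hb : ∀ᵐ z ∂ν, ‖z2 z‖ ≤ 1) (f : Lp ℂ 2 ν)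
    (k : ℕ) : ((mulZ2 hb)^[k] f : Lp ℂ 2 ν) =ᵐ[ν] fun z => z2 z ^ k * f z := by
  induction k with
  | zero => simp
  | succ k ih =>
    rw [Function.iterate_succ_apply']
    filter_upwards [coeFn_mulZ2 hb ((mulZ2 hb)^[k] f), ih] with z h1 h2
    rw [h1, h2, pow_succ]
    ring

theorem mulZ2_mem_hardySpace {Ω : Set C2} {ν : Measure C2} (hb : ∀ᵐ z ∂ν, ‖z2 z‖ ≤ 1)
    {k : ℕ} {f : Lp ℂ 2 ν} (hf : f ∈ hardySpace Ω ν z2 (k + 1)) :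
    mulZ2 hb f ∈ hardySpace Ω ν z2 k := by
  refine map_mem_closure (mulZ2 hb).continuous hf ?_
  rintro f ⟨F, ⟨⟨G, hG, hFG⟩, h0, hm⟩, hfF⟩
  refine ⟨fun z => z2 z * F z, ⟨⟨G, hG, fun z hz hψ => ?_⟩, fun z hz hψ => ?_,
    memLp_z2_mul hb hm⟩, ?_⟩
  · simp only
    rw [hFG z hz hψ, pow_succ]
    have := pow_ne_zero k hψ
    field_simp
  · simp only [hψ, zero_mul]
  · filter_upwards [coeFn_mulZ2 hb f, hfF] with z h1 h2
    rw [h1, h2]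

theorem norm_sq_eq_integral {ν : Measure C2} {f : Lp ℂ 2 ν} {F : C2 → ℂ} (h : f =ᵐ[ν] F) :
    ‖f‖ ^ 2 = ∫ z, ‖F z‖ ^ 2 ∂ν := by
  have hF : AEStronglyMeasurable F ν := (Lp.aestronglyMeasurable f).congr h
  rw [integral_eq_lintegral_of_nonneg_ae (ae_of_all _ fun z => by positivity)
    (by fun_prop : AEStronglyMeasurable (fun z => ‖F z‖ ^ 2) ν), Lp.norm_def, eLpNorm_congr_ae h, ← ENNReal.toReal_pow, eLpNorm_two_sq]
  congr 1
  refine lintegral_congr fun z => ?_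
  rw [ENNReal.ofReal_pow (norm_nonneg _), ofReal_norm]

namespace IsEggMeasure

variable {p : ℕ} {ν : Measure C2} (hν : IsEggMeasure p ν)
include hν

theorem ae_norm_le_one (hp : 1 ≤ p) : ∀ᵐ z ∂ν, ‖z 0‖ ≤ 1 ∧ ‖z 1‖ ≤ 1 := by
  filter_upwards [hν.ae_norm_eq] with z hz
  have h0 : 0 ≤ ‖z 0‖ ^ (2 * p) := by positivity
  have h1 : 0 ≤ ‖z 1‖ ^ (2 * p) := by positivity
  exact ⟨(pow_le_one_iff_of_nonneg (n := 2 * p) (norm_nonneg _) (by omega)).1 (by linarith),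
    (pow_le_one_iff_of_nonneg (n := 2 * p) (norm_nonneg _) (by omega)).1 (by linarith)⟩

theorem ae_norm_z2_le_one (hp : 1 ≤ p) : ∀ᵐ z ∂ν, ‖z2 z‖ ≤ 1 :=
  (hν.ae_norm_le_one hp).mono fun _ h => h.2

/-- The powers of `z₁` concentrate near `{z₂ = 0}`. -/
theorem exists_integral_gt (hp : 1 ≤ p)
    (hpos : ∀ δ : ℝ, 0 < δ → 0 < ν {z | ‖z 1‖ < δ}) {C : ℝ} (hC : 0 ≤ C) :
    ∃ n : ℕ, C * ∫ z, ‖z 0‖ ^ (2 * p * n) * ‖z 1‖ ^ 2 ∂ν < ∫ z, ‖z 0‖ ^ (2 * p * n) ∂ν := by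
  have := hν.finite
  by_contra! hcon
  -- The choice of `ε` gives `1 - C|z₂|² ≥ 1/2` where `|z₂| < ε`.
  obtain ⟨ε, hε0, hε1, hεC⟩ : ∃ ε : ℝ, 0 < ε ∧ ε < 1 ∧ C * ε ^ 2 ≤ 1 / 2 := by
    refine ⟨1 / (2 * (C + 1)), by positivity, ?_, ?_⟩
    · rw [div_lt_one (by positivity)]; linarith
    · rw [div_pow, one_pow, mul_one_div, div_le_iff₀ (by positivity)]
      nlinarith
  -- On the boundary `|z₁|^(2p) = 1 - |z₂|^(2p)`, which is at most `Q` where `|z₂| ≥ ε` and at least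
  -- `Q' > Q` where `|z₂| < ε/2`. The second set has positive mass `v`, so `Q' ^ n` outgrows `Q ^
  -- n`.
  set Q := 1 - ε ^ (2 * p) with hQ
  set Q' := 1 - (ε / 2) ^ (2 * p) with hQ'
  have hεp : ε ^ (2 * p) < 1 := pow_lt_one₀ hε0.le hε1 (by omega)
  have hlt : (ε / 2) ^ (2 * p) < ε ^ (2 * p) :=
    pow_lt_pow_left₀ (by linarith) (by positivity) (by omega)
  have hQ0 : 0 < Q := by linarith
  have hQQ : Q < Q' := by linarith
  set s : Set C2 := {z | ‖z 1‖ < ε / 2} with hs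
  have hsm : MeasurableSet s := measurableSet_lt (by fun_prop) measurable_const
  set v := ν.real s with hv
  have hv0 : 0 < v := ENNReal.toReal_pos (hpos _ (by positivity)).ne' (measure_ne_top _ _)
  have hbd : ∀ n : ℕ, v / 2 * Q' ^ n ≤ C * ν.real univ * Q ^ n := by
    intro n
    have hi1 : Integrable (fun z : C2 => ‖z 0‖ ^ (2 * p * n)) ν := by
      refine Integrable.of_bound (C := 1) (Continuous.aestronglyMeasurable (by fun_prop)) ?_
      filter_upwards [hν.ae_norm_le_one hp] with z hz
      rw [norm_pow, norm_norm]
      exact pow_le_one₀ (norm_nonneg _) hz.1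
    have hi2 : Integrable (fun z : C2 => ‖z 0‖ ^ (2 * p * n) * ‖z 1‖ ^ 2) ν := by
      refine Integrable.of_bound (C := 1) (Continuous.aestronglyMeasurable (by fun_prop)) ?_
      filter_upwards [hν.ae_norm_le_one hp] with z hz
      rw [norm_mul, norm_pow, norm_norm, norm_pow, norm_norm]
      exact mul_le_one₀ (pow_le_one₀ (norm_nonneg _) hz.1) (by positivity)
        (pow_le_one₀ (norm_nonneg _) hz.2)
    have hle : ∫ z, (s.indicator (fun _ => 1 / 2 * Q' ^ n) z - C * Q ^ n) ∂ν ≤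
        ∫ z, (‖z 0‖ ^ (2 * p * n) - C * (‖z 0‖ ^ (2 * p * n) * ‖z 1‖ ^ 2)) ∂ν := by
      refine integral_mono_ae (((integrable_const _).indicator hsm).sub (integrable_const _))
        (hi1.sub (hi2.const_mul C)) ?_
      filter_upwards [hν.ae_norm_le_one hp, hν.ae_norm_eq] with z hz hz'
      have hx : ‖z 0‖ ^ (2 * p) = 1 - ‖z 1‖ ^ (2 * p) := by linarith
      have hfac : ‖z 0‖ ^ (2 * p * n) - C * (‖z 0‖ ^ (2 * p * n) * ‖z 1‖ ^ 2) =
          (‖z 0‖ ^ (2 * p)) ^ n * (1 - C * ‖z 1‖ ^ 2) := by rw [pow_mul]; ring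
      have hx0 : 0 ≤ ‖z 0‖ ^ (2 * p) := by positivity
      rw [hfac]
      have hCQ : 0 ≤ C * Q ^ n := by positivity
      by_cases h1 : ‖z 1‖ < ε / 2
      · have hzs : z ∈ s := h1
        rw [indicator_of_mem hzs]
        have h2 : Q' ≤ ‖z 0‖ ^ (2 * p) := by
          rw [hx, hQ']
          have := pow_le_pow_left₀ (norm_nonneg (z 1)) h1.le (2 * p)
          linarith
        have h3 : Q' ^ n ≤ (‖z 0‖ ^ (2 * p)) ^ n := pow_le_pow_left₀ (by linarith) h2 n
        have h4 : ‖z 1‖ ^ 2 ≤ ε ^ 2 := pow_le_pow_left₀ (norm_nonneg _) (by linarith) 2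
        have h5 : 1 / 2 ≤ 1 - C * ‖z 1‖ ^ 2 := by nlinarith
        have h6 : Q' ^ n * (1 / 2) ≤ (‖z 0‖ ^ (2 * p)) ^ n * (1 - C * ‖z 1‖ ^ 2) :=
          mul_le_mul h3 h5 (by norm_num) (by positivity)
        linarith
      · have hzs : z ∉ s := h1
        rw [indicator_of_notMem hzs, zero_sub]
        by_cases h2 : ‖z 1‖ < ε
        · have h4 : ‖z 1‖ ^ 2 ≤ ε ^ 2 := pow_le_pow_left₀ (norm_nonneg _) h2.le 2
          have h5 : 0 ≤ 1 - C * ‖z 1‖ ^ 2 := by nlinarith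
          have : 0 ≤ (‖z 0‖ ^ (2 * p)) ^ n * (1 - C * ‖z 1‖ ^ 2) := by positivity
          linarith
        · have h3 : ‖z 0‖ ^ (2 * p) ≤ Q := by
            rw [hx, hQ]
            have := pow_le_pow_left₀ hε0.le (not_lt.1 h2) (2 * p)
            linarith
          have h4 : (‖z 0‖ ^ (2 * p)) ^ n ≤ Q ^ n := pow_le_pow_left₀ hx0 h3 n
          have h5 : ‖z 1‖ ^ 2 ≤ 1 := pow_le_one₀ (norm_nonneg _) hz.2
          have h6 : 0 ≤ (‖z 0‖ ^ (2 * p)) ^ n := by positivity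
          have h7 : (‖z 0‖ ^ (2 * p)) ^ n * ‖z 1‖ ^ 2 ≤ Q ^ n :=
            (mul_le_of_le_one_right h6 h5).trans h4
          nlinarith
    rw [integral_sub ((integrable_const _).indicator hsm) (integrable_const _),
      integral_sub hi1 (hi2.const_mul C), integral_const_mul C (fun z : C2 => _ * _),
      integral_indicator_const _ hsm, integral_const, smul_eq_mul, smul_eq_mul] at hle
    have := hcon n
    change v * _ - _ ≤ _ at hle
    linarith
  have hr : Tendsto (fun n : ℕ => C * ν.real univ * (Q / Q') ^ n) atTop (𝓝 0) := by
    have := (tendsto_pow_atTop_nhds_zero_of_lt_one (r := Q / Q')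
      (div_nonneg hQ0.le (hQ0.trans hQQ).le)
      ((div_lt_one (by linarith)).2 hQQ)).const_mul (C * ν.real univ)
    simpa using this
  have hge : v / 2 ≤ 0 := by
    refine ge_of_tendsto' hr fun n => ?_
    have hq : 0 < Q' ^ n := pow_pos (by linarith) n
    rw [div_pow, ← mul_div_assoc, le_div_iff₀ hq]
    exact hbd n
  linarith

/-- Surjectivity between these closed subspaces would, by the open mapping theorem and injectivity,
bound `‖f‖` by a multiple of `‖z₂ f‖`; powers of `z₁` contradict this. -/
theorem not_surjOn_mulZ2 (hp : 1 ≤ p)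
    (hpos : ∀ δ : ℝ, 0 < δ → 0 < ν {z | ‖z 1‖ < δ}) (k : ℕ) :
    ¬ ∀ g ∈ hardySpace (egg p) ν z2 k, ∃ h ∈ hardySpace (egg p) ν z2 (k + 1),
      mulZ2 (hν.ae_norm_z2_le_one hp) h = g := by
  have := hν.finite
  intro hsurj
  set M := mulZ2 (hν.ae_norm_z2_le_one hp)
  let E₁ := (boundaryValues (egg p) ν z2 (k + 1)).topologicalClosure
  let E₀ := (boundaryValues (egg p) ν z2 k).topologicalClosure
  let L : E₁ →L[ℂ] E₀ := (M.comp E₁.subtypeL).codRestrict E₀ fun f =>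
    mulZ2_mem_hardySpace (hν.ae_norm_z2_le_one hp) f.2
  have hL : Function.Surjective L := by
    rintro ⟨g, hg⟩
    obtain ⟨h, hh, rfl⟩ := hsurj g hg
    exact ⟨⟨h, hh⟩, rfl⟩
  obtain ⟨C, hC0, hC⟩ := L.exists_preimage_norm_le hL
  obtain ⟨n, hn⟩ := hν.exists_integral_gt hp hpos (C := C ^ 2) (by positivity)
  -- The exponent `p * n` makes `|F|²` the `n`-th power of `|z₁|^(2p)`, as in `exists_integral_gt`.
  set F : C2 → ℂ := laurentMonomial ![((p * n : ℕ) : ℤ), 0] with hF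
  have hFeq : ∀ᵐ z ∂ν, F z = z 0 ^ (p * n) := by
    filter_upwards [hν.ae_snd_ne_zero] with z hz
    rw [hF, laurentMonomial_of_ne hz]
    simp [← zpow_natCast]
  have hFL : MemLp F 2 ν := by
    refine MemLp.of_bound (measurable_laurentMonomial _).aestronglyMeasurable 1 ?_
    filter_upwards [hFeq, hν.ae_norm_le_one hp] with z hz hz'
    rw [hz, norm_pow]
    exact pow_le_one₀ (norm_nonneg _) hz'.1
  have hmem : F ∈ holoContPole (egg p) ν z2 (k + 1) :=
    laurentMonomial_mem_holoContPole (Int.natCast_nonneg (p * n))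
      (by change _ ≤ (0 : ℤ); omega) hFL
  let f : E₁ := ⟨hFL.toLp F, subset_closure (toLp_mem_boundaryValues hmem)⟩
  obtain ⟨x, hx, hxn⟩ := hC (L f)
  -- The norm-controlled preimage must be `F` itself, since `z₂ ≠ 0` almost everywhere.
  have hxf : (x : Lp ℂ 2 ν) = hFL.toLp F := by
    have h1 : M x = M (hFL.toLp F) := congrArg Subtype.val hx
    apply Lp.ext
    filter_upwards [coeFn_mulZ2 (hν.ae_norm_z2_le_one hp) (x : Lp ℂ 2 ν),
      coeFn_mulZ2 (hν.ae_norm_z2_le_one hp) (hFL.toLp F), hν.ae_snd_ne_zero] with z h2 h3 h4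
    have h5 : z2 z * (x : Lp ℂ 2 ν) z = z2 z * (hFL.toLp F : Lp ℂ 2 ν) z := by
      rw [← h2, ← h3]; exact congrArg (fun f : Lp ℂ 2 ν => f z) h1
    exact mul_left_cancel₀ h4 h5
  have hnorm : ‖hFL.toLp F‖ ≤ C * ‖M (hFL.toLp F)‖ := by
    rw [← hxf]
    refine hxn.trans_eq ?_
    rw [hxf]
    rfl
  have hsq : ‖hFL.toLp F‖ ^ 2 ≤ C ^ 2 * ‖M (hFL.toLp F)‖ ^ 2 := by
    rw [← mul_pow]
    exact pow_le_pow_left₀ (norm_nonneg _) hnorm 2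
  have e1 : hFL.toLp F =ᵐ[ν] fun z => z 0 ^ (p * n) := hFL.coeFn_toLp.trans hFeq
  have e2 : M (hFL.toLp F) =ᵐ[ν] fun z => z 1 * z 0 ^ (p * n) := by
    filter_upwards [coeFn_mulZ2 (hν.ae_norm_z2_le_one hp) (hFL.toLp F), e1] with z h1 h2
    rw [h1, h2, z2]
  rw [norm_sq_eq_integral e1, norm_sq_eq_integral e2] at hsq
  have i1 : ∀ z : C2, ‖z 0 ^ (p * n)‖ ^ 2 = ‖z 0‖ ^ (2 * p * n) := fun z => by
    rw [norm_pow, ← pow_mul]; ring_nf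
  have i2 : ∀ z : C2, ‖z 1 * z 0 ^ (p * n)‖ ^ 2 = ‖z 0‖ ^ (2 * p * n) * ‖z 1‖ ^ 2 := fun z => by
    rw [norm_mul, mul_pow, i1, mul_comm]
  simp_rw [i1, i2] at hsq
  linarith

/-- Multiplication by `z₂` gives a strictly decreasing chain. -/
theorem mulPowSet_hardySpace_ssubset (hp : 1 ≤ p)
    (hpos : ∀ δ : ℝ, 0 < δ → 0 < ν {z | ‖z 1‖ < δ}) (k : ℕ) :
    mulPowSet z2 (k + 1) (hardySpace (egg p) ν z2 (k + 1)) ⊂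
      mulPowSet z2 k (hardySpace (egg p) ν z2 k) := by
  have hb := hν.ae_norm_z2_le_one hp
  refine ⟨?_, fun hsub => hν.not_surjOn_mulZ2 hp hpos k fun g hg => ?_⟩
  · rintro f ⟨g, hg, hfg⟩
    refine ⟨mulZ2 hb g, mulZ2_mem_hardySpace hb hg, ?_⟩
    filter_upwards [hfg, coeFn_mulZ2 hb g] with z h1 h2
    rw [h1, h2, pow_succ, mul_assoc]
  · obtain ⟨h, hh, he⟩ := hsub ⟨g, hg, coeFn_mulZ2_iterate hb g k⟩
    refine ⟨h, hh, ?_⟩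
    apply Lp.ext
    filter_upwards [he, coeFn_mulZ2_iterate hb g k, coeFn_mulZ2 hb h, hν.ae_snd_ne_zero]
      with z h1 h2 h3 h4
    rw [h3]
    rw [h2, pow_succ, mul_assoc] at h1
    exact (mul_left_cancel₀ (pow_ne_zero k h4) h1).symm

end IsEggMeasure

/-! ### Surface area on the boundary of the egg -/

theorem frontier_egg {p : ℕ} (hp : 1 ≤ p) :
    frontier (egg p) = {z | ‖z 0‖ ^ (2 * p) + ‖z 1‖ ^ (2 * p) = 1} := by
  have hc : Continuous fun z : C2 => ‖z 0‖ ^ (2 * p) + ‖z 1‖ ^ (2 * p) := by fun_prop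
  refine Subset.antisymm (frontier_lt_subset_eq hc continuous_const) fun z hz => ?_
  have hz : ‖z 0‖ ^ (2 * p) + ‖z 1‖ ^ (2 * p) = 1 := hz
  have ho : IsOpen (egg p) := isOpen_lt hc continuous_const
  rw [ho.frontier_eq]
  refine ⟨?_, fun h => (lt_irrefl (1 : ℝ)) (hz.symm.trans_lt h)⟩
  -- Radial contractions of a boundary point lie in the egg, because the defining function is
  -- homogeneous of degree `2p`.
  have hlim : Tendsto (fun n : ℕ => (1 - 1 / ((n : ℝ) + 1)) • z) atTop (𝓝 z) := by
    have h1 : Tendsto (fun n : ℕ => 1 - 1 / ((n : ℝ) + 1)) atTop (𝓝 (1 - 0)) :=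
      tendsto_const_nhds.sub tendsto_one_div_add_atTop_nhds_zero_nat
    have := h1.smul_const z
    simpa using this
  refine mem_closure_of_tendsto hlim (Eventually.of_forall fun n => ?_)
  have hn : (0 : ℝ) < n + 1 := by positivity
  set s : ℝ := 1 - 1 / ((n : ℝ) + 1) with hs
  have hs0 : 0 ≤ s := by
    rw [hs, sub_nonneg, div_le_one hn]; linarith [(Nat.cast_nonneg n : (0 : ℝ) ≤ n)]
  have hs1 : s < 1 := by
    have : 0 < 1 / ((n : ℝ) + 1) := by positivity
    linarith
  change ‖(s • z) 0‖ ^ (2 * p) + ‖(s • z) 1‖ ^ (2 * p) < 1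
  have e : ∀ i, ‖(s • z) i‖ = s * ‖z i‖ := fun i => by
    rw [PiLp.smul_apply, norm_smul, Real.norm_of_nonneg hs0]
  rw [e, e, mul_pow, mul_pow, ← mul_add, hz, mul_one]
  exact pow_lt_one₀ hs0 hs1 (by omega)

theorem isometry_torusRot (t : Torus2) : Isometry (torusRot t) := by
  refine Isometry.of_dist_eq fun z w => ?_
  rw [EuclideanSpace.dist_eq, EuclideanSpace.dist_eq, Fin.sum_univ_two, Fin.sum_univ_two]
  simp only [torusRot_apply_zero, torusRot_apply_one, dist_eq_norm, ← mul_sub, norm_mul]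
  rw [norm_fourier_apply, norm_fourier_apply, one_mul, one_mul]

theorem torusRot_neg_torusRot (t : Torus2) (z : C2) : torusRot (-t) (torusRot t z) = z := by
  have h : ∀ s : UnitAddCircle, (fourier 1 (-s) : ℂ) * fourier 1 s = 1 := fun s => by
    rw [fourier_one, fourier_one, ← Circle.coe_mul, ← AddCircle.toCircle_add, neg_add_cancel,
      AddCircle.toCircle_zero, Circle.coe_one]
  ext i
  fin_cases i
  · change fourier 1 (-t 0) * (fourier 1 (t 0) * z 0) = z 0
    rw [← mul_assoc, h, one_mul]
  · change fourier 1 (-t 1) * (fourier 1 (t 1) * z 1) = z 1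
    rw [← mul_assoc, h, one_mul]

/-- The torus acts on `ℂ²` by isometries. -/
noncomputable def torusRotEquiv (t : Torus2) : C2 ≃ᵢ C2 where
  toFun := torusRot t
  invFun := torusRot (-t)
  left_inv := torusRot_neg_torusRot t
  right_inv := fun z => by simpa using torusRot_neg_torusRot (-t) z
  isometry_toFun := isometry_torusRot t

theorem norm_torusRot_zero (t : Torus2) (z : C2) : ‖torusRot t z 0‖ = ‖z 0‖ := by
  rw [torusRot_apply_zero, norm_mul, norm_fourier_apply, one_mul]

theorem norm_torusRot_one (t : Torus2) (z : C2) : ‖torusRot t z 1‖ = ‖z 1‖ := by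
  rw [torusRot_apply_one, norm_mul, norm_fourier_apply, one_mul]

theorem measurePreserving_torusRot_eggSigma {p : ℕ} (hp : 1 ≤ p) (t : Torus2) :
    MeasurePreserving (torusRot t) (eggSigma p) (eggSigma p) := by
  have h := ((torusRotEquiv t).measurePreserving_euclideanHausdorffMeasure 3).restrict_preimage
    (s := frontier (egg p)) isClosed_frontier.measurableSet
  have h2 : (torusRotEquiv t) ⁻¹' frontier (egg p) = frontier (egg p) := by
    rw [frontier_egg hp]
    ext z
    change ‖torusRot t z 0‖ ^ (2 * p) + ‖torusRot t z 1‖ ^ (2 * p) = 1 ↔ _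
    rw [norm_torusRot_zero, norm_torusRot_one]
    rfl
  rw [h2] at h
  exact h

theorem euclideanHausdorffMeasure_three_eq_zero {s : Set C2} (h : dimH s < 3) :
    μHE[3] s = 0 := by
  rw [Measure.euclideanHausdorffMeasure_def, Measure.smul_apply]
  have : μH[((3 : ℕ) : ℝ)] s = 0 := by
    have := hausdorffMeasure_of_dimH_lt (s := s) (d := 3) (by exact_mod_cast h)
    simpa using this
  rw [this, smul_zero]

theorem ae_eggSigma_of_dimH_lt {p : ℕ} {s : Set C2} (h : dimH s < 3) :
    ∀ᵐ z ∂eggSigma p, z ∉ s := by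
  refine ae_restrict_of_ae ?_
  exact measure_eq_zero_iff_ae_notMem.1 (euclideanHausdorffMeasure_three_eq_zero h)

/-- A smooth image of the real plane has dimension at most two; applied to the coordinate axes, this
makes them null for surface area. -/
theorem dimH_range_complex_lt {f : ℂ → C2} (hf : ContDiff ℝ 1 f) : dimH (range f) < 3 := by
  refine hf.dimH_range_le.trans_lt ?_
  rw [Complex.finrank_real_complex]
  norm_num

theorem ae_eggSigma_fst_ne_zero (p : ℕ) : ∀ᵐ z ∂eggSigma p, z 0 ≠ 0 := by
  have hf : ContDiff ℝ 1 fun w : ℂ => (!₂[0, w] : C2) := by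
    rw [contDiff_piLp 2]
    intro i
    fin_cases i
    · exact contDiff_const
    · exact contDiff_id
  filter_upwards [ae_eggSigma_of_dimH_lt (dimH_range_complex_lt hf)] with z hz h0
  refine hz ⟨z 1, ?_⟩
  ext i
  fin_cases i
  · exact h0.symm
  · rfl

theorem ae_eggSigma_snd_ne_zero (p : ℕ) : ∀ᵐ z ∂eggSigma p, z 1 ≠ 0 := by
  have hf : ContDiff ℝ 1 fun w : ℂ => (!₂[w, 0] : C2) := by
    rw [contDiff_piLp 2]
    intro i
    fin_cases i
    · exact contDiff_id
    · exact contDiff_const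
  filter_upwards [ae_eggSigma_of_dimH_lt (dimH_range_complex_lt hf)] with z hz h0
  refine hz ⟨z 0, ?_⟩
  ext i
  fin_cases i
  · rfl
  · exact h0.symm

/-- A parametrization of the boundary of the egg. -/
noncomputable def eggParam (p : ℕ) (x : Fin 3 → ℝ) : C2 :=
  (((Real.cos (x 0) ^ 2) ^ p + (Real.sin (x 0) ^ 2) ^ p) ^ (-(1 / (2 * p : ℝ)))) •
    !₂[(Real.cos (x 0) : ℂ) * Complex.exp (x 1 * Complex.I),
      (Real.sin (x 0) : ℂ) * Complex.exp (x 2 * Complex.I)]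

theorem contDiff_eggParam (p : ℕ) : ContDiff ℝ 1 (eggParam p) := by
  unfold eggParam
  have hx : ∀ i, ContDiff ℝ 1 fun x : Fin 3 → ℝ => x i := fun i => contDiff_apply ℝ ℝ i
  have hof : ∀ {f : (Fin 3 → ℝ) → ℝ}, ContDiff ℝ 1 f → ContDiff ℝ 1 fun x => (f x : ℂ) :=
    fun hf => Complex.ofRealCLM.contDiff.comp hf
  have hsmul : ∀ {f : (Fin 3 → ℝ) → ℝ} {g : (Fin 3 → ℝ) → C2}, ContDiff ℝ 1 f → ContDiff ℝ 1 g →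
      ContDiff ℝ 1 fun x => f x • g x := fun hf hg => hf.smul hg
  refine hsmul ?_ ?_
  · refine ContDiff.rpow_const_of_ne ?_ fun x => ?_
    · exact (((Real.contDiff_cos.comp (hx 0)).pow 2).pow p).add
        (((Real.contDiff_sin.comp (hx 0)).pow 2).pow p)
    · by_cases h : Real.cos (x 0) = 0
      · have h2 : Real.sin (x 0) ^ 2 = 1 := by
          have := Real.sin_sq_add_cos_sq (x 0); rw [h] at this; linarith
        rw [h2, one_pow]; positivity
      · have : 0 < (Real.cos (x 0) ^ 2) ^ p := by positivity
        positivity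
  · rw [contDiff_piLp 2]
    intro i
    fin_cases i
    · exact (hof (Real.contDiff_cos.comp (hx 0))).mul
        (((hof (hx 1)).mul contDiff_const).cexp)
    · exact (hof (Real.contDiff_sin.comp (hx 0))).mul
        (((hof (hx 2)).mul contDiff_const).cexp)

theorem frontier_egg_subset_image {p : ℕ} (hp : 1 ≤ p) :
    frontier (egg p) ⊆ eggParam p '' Icc (fun _ => -Real.pi) (fun _ => Real.pi) := by
  rw [frontier_egg hp]
  intro z hz
  have hz : ‖z 0‖ ^ (2 * p) + ‖z 1‖ ^ (2 * p) = 1 := hz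
  -- The argument of `|z₁| + i|z₂|` is the first parameter, and its modulus is the value of the
  -- radial factor there.
  set c : ℂ := ⟨‖z 0‖, ‖z 1‖⟩ with hc
  have hc0 : c ≠ 0 := by
    intro h
    have h0 : ‖z 0‖ = 0 := congrArg Complex.re h
    have h1 : ‖z 1‖ = 0 := congrArg Complex.im h
    rw [h0, h1, zero_pow (by omega)] at hz
    norm_num at hz
  have hcpos : 0 < ‖c‖ := norm_pos_iff.2 hc0
  refine ⟨![c.arg, (z 0).arg, (z 1).arg], ⟨fun i => ?_, fun i => ?_⟩, ?_⟩
  · fin_cases i <;> exact (Complex.neg_pi_lt_arg _).le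
  · fin_cases i <;> exact Complex.arg_le_pi _
  have hcos : Real.cos c.arg = ‖z 0‖ / ‖c‖ := Complex.cos_arg hc0
  have hsin : Real.sin c.arg = ‖z 1‖ / ‖c‖ := Complex.sin_arg c
  have hN : ((Real.cos c.arg ^ 2) ^ p + (Real.sin c.arg ^ 2) ^ p) ^ (-(1 / (2 * p : ℝ))) =
      ‖c‖ := by
    rw [hcos, hsin, ← pow_mul, ← pow_mul, div_pow, div_pow, ← add_div, hz, one_div,
      Real.inv_rpow (by positivity), Real.rpow_neg (by positivity), inv_inv]
    have : (1 / (2 * p : ℝ)) = ((2 * p : ℕ) : ℝ)⁻¹ := by push_cast; rw [one_div]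
    rw [this, Real.pow_rpow_inv_natCast hcpos.le (by omega)]
  have hcc : (‖c‖ : ℂ) ≠ 0 := by exact_mod_cast hcpos.ne'
  unfold eggParam
  simp only [Matrix.cons_val_zero, Matrix.cons_val_one, Matrix.cons_val]
  rw [hN, hcos, hsin]
  ext i
  fin_cases i
  · change (‖c‖ : ℝ) • (((‖z 0‖ / ‖c‖ : ℝ) : ℂ) * Complex.exp ((z 0).arg * Complex.I)) = z 0
    rw [Complex.real_smul, Complex.ofReal_div, ← mul_assoc, mul_div_cancel₀ _ hcc,
      Complex.norm_mul_exp_arg_mul_I]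
  · change (‖c‖ : ℝ) • (((‖z 1‖ / ‖c‖ : ℝ) : ℂ) * Complex.exp ((z 1).arg * Complex.I)) = z 1
    rw [Complex.real_smul, Complex.ofReal_div, ← mul_assoc, mul_div_cancel₀ _ hcc,
      Complex.norm_mul_exp_arg_mul_I]

/-- The boundary is covered by a Lipschitz image of a compact box in three real parameters. -/
theorem isFiniteMeasure_eggSigma {p : ℕ} (hp : 1 ≤ p) : IsFiniteMeasure (eggSigma p) := by
  refine ⟨?_⟩
  rw [eggSigma, surfaceMeasure, Measure.restrict_apply_univ]
  set Q : Set (Fin 3 → ℝ) := Icc (fun _ => -Real.pi) (fun _ => Real.pi)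
  have hQ : IsCompact Q := isCompact_Icc
  obtain ⟨K, hK⟩ := ((contDiff_eggParam p).locallyLipschitz.locallyLipschitzOn
    (s := Q)).exists_lipschitzOnWith_of_compact hQ
  refine (measure_mono (frontier_egg_subset_image hp)).trans_lt ?_
  rw [Measure.euclideanHausdorffMeasure_def, Measure.smul_apply]
  have h1 := hK.hausdorffMeasure_image_le (d := ((3 : ℕ) : ℝ)) (by positivity)
  have h2 : (μH[((3 : ℕ) : ℝ)] : Measure (Fin 3 → ℝ)) = volume := by
    have := hausdorffMeasure_pi_real (ι := Fin 3)
    simpa using this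
  rw [h2] at h1
  have h3 : μH[((3 : ℕ) : ℝ)] (eggParam p '' Q) < ⊤ := by
    refine h1.trans_lt (ENNReal.mul_lt_top ?_ hQ.measure_lt_top)
    exact ENNReal.rpow_lt_top_of_nonneg (by positivity) (by simp)
  exact ENNReal.mul_lt_top ENNReal.coe_lt_top h3

theorem isEggMeasure_eggSigma {p : ℕ} (hp : 1 ≤ p) : IsEggMeasure p (eggSigma p) where
  finite := isFiniteMeasure_eggSigma hp
  ae_norm_eq := by
    filter_upwards [ae_restrict_mem (isClosed_frontier (s := egg p)).measurableSet] with z hz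
    rw [frontier_egg hp] at hz
    exact hz
  measurePreserving_torusRot := measurePreserving_torusRot_eggSigma hp
  ae_fst_ne_zero := ae_eggSigma_fst_ne_zero p
  ae_snd_ne_zero := ae_eggSigma_snd_ne_zero p

/-! ### Failure of integrability of `|z₂|⁻²` for surface area -/

/-- Projection of `ℂ²` to three real coordinates. -/
noncomputable def realProj (z : C2) : Fin 3 → ℝ := ![(z 0).im, (z 1).re, (z 1).im]

theorem lipschitzWith_realProj : LipschitzWith 1 realProj := by
  refine LipschitzWith.of_dist_le_mul fun z w => ?_
  rw [NNReal.coe_one, one_mul, dist_pi_le_iff dist_nonneg]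
  have h : ∀ i, ‖z i - w i‖ ≤ dist z w := fun i => by
    rw [dist_eq_norm]
    exact PiLp.norm_apply_le (z - w) i
  intro i
  fin_cases i
  · exact (Complex.abs_im_le_norm (z 0 - w 0)).trans (h 0)
  · exact (Complex.abs_re_le_norm (z 1 - w 1)).trans (h 1)
  · exact (Complex.abs_im_le_norm (z 1 - w 1)).trans (h 1)

/-- The part of the boundary of the egg where `|z₂|` is comparable to `h`. -/
def eggShell (p : ℕ) (h : ℝ) : Set C2 := {z ∈ frontier (egg p) | h ≤ ‖z 1‖ ∧ ‖z 1‖ < 4 * h}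

theorem measurableSet_eggShell (p : ℕ) (h : ℝ) : MeasurableSet (eggShell p h) := by
  have hm : Measurable fun z : C2 => ‖z 1‖ := by fun_prop
  exact (isClosed_frontier.measurableSet).inter
    ((measurableSet_le measurable_const hm).inter (measurableSet_lt hm measurable_const))

/-- Near `{z₂ = 0}` the boundary equation can be solved for `Re z₁` in terms of the other three real
coordinates. -/
theorem Icc_subset_realProj_image {p : ℕ} (hp : 1 ≤ p) {h : ℝ} (h0 : 0 < h) (h1 : h ≤ 1 / 16) :
    Icc ![0, h, h] ![1 / 2, 2 * h, 2 * h] ⊆ realProj '' eggShell p h := by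
  rintro x ⟨hl, hu⟩
  have l0 : 0 ≤ x 0 := hl 0
  have l1 : h ≤ x 1 := hl 1
  have l2 : h ≤ x 2 := hl 2
  have u0 : x 0 ≤ 1 / 2 := hu 0
  have u1 : x 1 ≤ 2 * h := hu 1
  have u2 : x 2 ≤ 2 * h := hu 2
  set w : ℂ := ⟨x 1, x 2⟩ with hw
  have hw2 : ‖w‖ ^ 2 = x 1 ^ 2 + x 2 ^ 2 := by
    rw [← Complex.normSq_eq_norm_sq, Complex.normSq_mk]; ring
  have hwl : h ≤ ‖w‖ := by
    refine (sq_le_sq₀ h0.le (norm_nonneg _)).1 ?_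
    rw [hw2]; nlinarith
  have hwu : ‖w‖ < 4 * h := by
    refine (sq_lt_sq₀ (norm_nonneg _) (by positivity)).1 ?_
    rw [hw2]; nlinarith
  have hw1 : ‖w‖ ≤ 1 / 4 := by linarith
  have hwp : ‖w‖ ^ (2 * p) ≤ 1 / 16 := by
    have h2 : ‖w‖ ^ (2 * p) ≤ ‖w‖ ^ 2 :=
      pow_le_pow_of_le_one (norm_nonneg _) (by linarith) (by omega)
    nlinarith [norm_nonneg w]
  set b : ℝ := 1 - ‖w‖ ^ (2 * p) with hb
  have hb0 : 0 ≤ b := by linarith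
  -- `R` is the value of `|z₁|²` dictated by the boundary equation; `R ≥ 1/4 ≥ (x 0)²` makes the
  -- square root legitimate.
  set R : ℝ := b ^ ((p : ℝ)⁻¹) with hR
  have hRp : R ^ p = b := Real.rpow_inv_natCast_pow hb0 (by omega)
  have hR0 : 0 ≤ R := Real.rpow_nonneg hb0 _
  have hRb : 1 / 4 ≤ R := by
    by_contra hlt
    have hlt := not_le.1 hlt
    have h2 : R ^ p ≤ R ^ 1 := pow_le_pow_of_le_one hR0 (by linarith) hp
    rw [hRp, pow_one] at h2
    linarith
  have hRy : 0 ≤ R - x 0 ^ 2 := by nlinarith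
  refine ⟨!₂[⟨Real.sqrt (R - x 0 ^ 2), x 0⟩, w], ⟨?_, hwl, hwu⟩, ?_⟩
  · rw [frontier_egg hp]
    change ‖(⟨Real.sqrt (R - x 0 ^ 2), x 0⟩ : ℂ)‖ ^ (2 * p) + ‖w‖ ^ (2 * p) = 1
    have : ‖(⟨Real.sqrt (R - x 0 ^ 2), x 0⟩ : ℂ)‖ ^ 2 = R := by
      rw [← Complex.normSq_eq_norm_sq, Complex.normSq_mk, Real.mul_self_sqrt hRy]; ring
    rw [pow_mul, this, hRp]
    linarith
  · ext i
    fin_cases i <;> rfl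

/-- A 1-Lipschitz projection does not increase Hausdorff measure, so the shell has at least a fixed
multiple of the volume `h²/2` of the box it covers. -/
theorem exists_eggSigma_eggShell_ge {p : ℕ} (hp : 1 ≤ p) :
    ∃ c : ℝ≥0∞, c ≠ 0 ∧ ∀ h : ℝ, 0 < h → h ≤ 1 / 16 →
      c * ENNReal.ofReal (h ^ 2) ≤ eggSigma p (eggShell p h) := by
  set a := Measure.addHaarScalarFactor (volume : Measure (EuclideanSpace ℝ (Fin 3))) μH[(3 : ℕ)]
    with ha
  refine ⟨a * ENNReal.ofReal (1 / 2), mul_ne_zero ?_ ?_, fun h h0 h1 => ?_⟩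
  · exact ENNReal.coe_ne_zero.2
      (Measure.addHaarScalarFactor_volume_hausdorffMeasure_ne_zero 3)
  · simp
  rw [eggSigma, surfaceMeasure, Measure.restrict_apply (measurableSet_eggShell p h),
    inter_eq_self_of_subset_left (fun z hz => hz.1), Measure.euclideanHausdorffMeasure_def,
    Measure.smul_apply, ENNReal.smul_def, smul_eq_mul, mul_assoc]
  refine mul_le_mul_right ?_ _
  have h2 : (μH[((3 : ℕ) : ℝ)] : Measure (Fin 3 → ℝ)) = volume := by
    have := hausdorffMeasure_pi_real (ι := Fin 3)
    simpa using this
  have h3 := lipschitzWith_realProj.hausdorffMeasure_image_le (d := ((3 : ℕ) : ℝ)) (by positivity)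
    (eggShell p h)
  rw [h2, ENNReal.coe_one, ENNReal.one_rpow, one_mul] at h3
  refine le_trans ?_ ((measure_mono (Icc_subset_realProj_image hp h0 h1)).trans h3)
  rw [Real.volume_Icc_pi, Fin.prod_univ_three, ← ENNReal.ofReal_mul (by norm_num)]
  simp only [Matrix.cons_val_zero, Matrix.cons_val_one, Matrix.cons_val]
  rw [← ENNReal.ofReal_mul (by norm_num), ← ENNReal.ofReal_mul (by nlinarith)]
  apply le_of_eq
  congr 1
  ring

/-- The function `|z₂|⁻²` is not integrable for the surface measure near `{z₂ = 0}`. -/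
theorem lintegral_eggSigma_eq_top {p : ℕ} (hp : 1 ≤ p) {f : C2 → ℝ≥0∞} {K : ℝ} (hK : 0 < K)
    (hf : ∀ z ∈ frontier (egg p), z 1 ≠ 0 → ‖z 1‖ ≤ 1 / 4 →
      ENNReal.ofReal (K / ‖z 1‖ ^ 2) ≤ f z) :
    ∫⁻ z, f z ∂eggSigma p = ⊤ := by
  obtain ⟨c, hc, hsh⟩ := exists_eggSigma_eggShell_ge hp
  -- The ratio `1/4` matches the shell `h ≤ |z₂| < 4h` and makes the shells disjoint. The shift by
  -- two keeps `h j ≤ 1/16`, hence `|z₂| ≤ 1/4`. On each shell the bounds `K / (16 h²)` and `c h²`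
  -- multiply to a constant independent of `j`.
  let h : ℕ → ℝ := fun j => (1 / 4) ^ (j + 2)
  have h0 : ∀ j, 0 < h j := fun j => by positivity
  have h1 : ∀ j, h j ≤ 1 / 16 := fun j => by
    have : h j ≤ (1 / 4) ^ 2 := pow_le_pow_of_le_one (by norm_num) (by norm_num) (by omega)
    linarith
  have hdisj : Pairwise (Function.onFun Disjoint fun j => eggShell p (h j)) := by
    have key : ∀ i j, i < j → Disjoint (eggShell p (h i)) (eggShell p (h j)) := by
      intro i j hij
      rw [Set.disjoint_left]
      intro z hi hj
      have : 4 * h j ≤ h i := by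
        have h2 : h j ≤ (1 / 4) ^ (i + 1 + 2) :=
          pow_le_pow_of_le_one (by norm_num) (by norm_num) (by omega)
        have h3 : (1 / 4 : ℝ) ^ (i + 1 + 2) = 1 / 4 * h i := by simp only [h]; ring
        linarith
      exact absurd hi.2.1 (not_le.2 (hj.2.2.trans_le this))
    intro i j hij
    rcases lt_or_gt_of_ne hij with h | h
    · exact key i j h
    · exact (key j i h).symm
  have hterm : ∀ j, c * ENNReal.ofReal (K / 16) ≤ ∫⁻ z in eggShell p (h j), f z ∂eggSigma p := by
    intro j
    have hlow : ∀ z ∈ eggShell p (h j), ENNReal.ofReal (K / (16 * h j ^ 2)) ≤ f z := by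
      intro z hz
      have hz0 : 0 < ‖z 1‖ := (h0 j).trans_le hz.2.1
      refine le_trans (ENNReal.ofReal_le_ofReal ?_) (hf z hz.1 (norm_pos_iff.1 hz0)
        (by linarith [hz.2.2, h1 j]))
      refine div_le_div_of_nonneg_left hK.le (by positivity) ?_
      nlinarith [hz.2.2, h0 j]
    calc c * ENNReal.ofReal (K / 16)
        = ENNReal.ofReal (K / (16 * h j ^ 2)) * (c * ENNReal.ofReal (h j ^ 2)) := by
          rw [mul_left_comm, ← ENNReal.ofReal_mul (by have := h0 j; positivity)]
          congr 2
          have := (h0 j).ne'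
          field_simp
      _ ≤ ENNReal.ofReal (K / (16 * h j ^ 2)) * eggSigma p (eggShell p (h j)) := by
          gcongr; exact hsh _ (h0 j) (h1 j)
      _ = ∫⁻ z in eggShell p (h j), ENNReal.ofReal (K / (16 * h j ^ 2)) ∂eggSigma p := by
          rw [setLIntegral_const]
      _ ≤ _ := setLIntegral_mono' (measurableSet_eggShell p _) hlow
  have hne : c * ENNReal.ofReal (K / 16) ≠ 0 :=
    mul_ne_zero hc (ENNReal.ofReal_pos.2 (by positivity)).ne'
  rw [eq_top_iff]
  calc (⊤ : ℝ≥0∞) = ∑' _ : ℕ, c * ENNReal.ofReal (K / 16) :=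
        (ENNReal.tsum_const_eq_top_of_ne_zero hne).symm
    _ ≤ ∑' j, ∫⁻ z in eggShell p (h j), f z ∂eggSigma p := ENNReal.tsum_le_tsum hterm
    _ = ∫⁻ z in ⋃ j, eggShell p (h j), f z ∂eggSigma p :=
        (lintegral_iUnion (fun j => measurableSet_eggShell p _) hdisj _).symm
    _ ≤ _ := setLIntegral_le_lintegral _ _

theorem half_le_norm_fst {p : ℕ} (hp : 1 ≤ p) {z : C2} (hz : z ∈ frontier (egg p))
    (h1 : ‖z 1‖ ≤ 1 / 4) : 1 / 2 ≤ ‖z 0‖ := by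
  rw [frontier_egg hp] at hz
  have hz : ‖z 0‖ ^ (2 * p) + ‖z 1‖ ^ (2 * p) = 1 := hz
  by_contra hlt
  have hlt := not_le.1 hlt
  have e0 : ‖z 0‖ ^ (2 * p) ≤ ‖z 0‖ ^ 1 :=
    pow_le_pow_of_le_one (norm_nonneg _) (by linarith) (by omega)
  have e1 : ‖z 1‖ ^ (2 * p) ≤ ‖z 1‖ ^ 1 :=
    pow_le_pow_of_le_one (norm_nonneg _) (by linarith) (by omega)
  rw [pow_one] at e0 e1
  linarith

/-- The exponent `2m + 2` leaves exactly `|z₂|⁻²` after multiplication by a density of size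
`|z₂|^(2m)`. -/
theorem le_norm_laurentMonomial_sq {p : ℕ} (hp : 1 ≤ p) {m : ℕ} {n : Fin 2 → ℤ} (h0 : 0 ≤ n 0)
    (h1 : n 1 < -(m : ℤ)) {z : C2} (hz : z ∈ frontier (egg p)) (hz1 : z 1 ≠ 0)
    (hz4 : ‖z 1‖ ≤ 1 / 4) :
    (1 / 2) ^ (2 * n 0) / ‖z 1‖ ^ (2 * m + 2) ≤ ‖laurentMonomial n z‖ ^ 2 := by
  have hpos : 0 < ‖z 1‖ := norm_pos_iff.2 hz1
  have hhalf := half_le_norm_fst hp hz hz4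
  rw [laurentMonomial_of_ne hz1, norm_mul, mul_pow, norm_zpow, norm_zpow, div_eq_mul_inv]
  have e0 : (1 / 2 : ℝ) ^ (2 * n 0) ≤ (‖z 0‖ ^ n 0) ^ 2 := by
    rw [← zpow_natCast, ← zpow_mul, mul_comm]
    exact zpow_le_zpow_left₀ (by omega) (by norm_num) hhalf
  have e1 : (‖z 1‖ ^ (2 * m + 2))⁻¹ ≤ (‖z 1‖ ^ n 1) ^ 2 := by
    rw [← zpow_natCast, ← zpow_natCast, ← zpow_mul, ← zpow_neg]
    refine zpow_le_zpow_right_of_le_one₀ hpos (by linarith) ?_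
    push_cast
    omega
  exact mul_le_mul e0 e1 (by positivity) (by positivity)

theorem not_memLp_laurentMonomial_eggSigma {p : ℕ} (hp : 1 ≤ p) {n : Fin 2 → ℤ} (h0 : 0 ≤ n 0)
    (h1 : n 1 < 0) : ¬ MemLp (laurentMonomial n) 2 (eggSigma p) := by
  intro hL
  have htop : ∫⁻ z, ‖laurentMonomial n z‖ₑ ^ 2 ∂eggSigma p = ⊤ := by
    refine lintegral_eggSigma_eq_top hp (K := (1 / 2) ^ (2 * n 0)) (by positivity)
      fun z hz hz1 hz4 => ?_
    rw [← ofReal_norm, ← ENNReal.ofReal_pow (norm_nonneg _)]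
    exact ENNReal.ofReal_le_ofReal
      (by simpa using le_norm_laurentMonomial_sq hp (m := 0) h0 (by simpa using h1) hz hz1 hz4)
  rw [← eLpNorm_two_sq] at htop
  exact ENNReal.pow_ne_top hL.2.ne htop

/-! ### The density of the Monge–Ampère form -/

open scoped RealInnerProductSpace

theorem hasFDerivAt_norm_sq_pow (i : Fin 2) (m : ℕ) (z : C2) :
    ∃ L : C2 →L[ℝ] ℝ, HasFDerivAt (fun x : C2 => (‖x i‖ ^ 2) ^ m) L z ∧
      ∀ v, L v = 2 * m * (‖z i‖ ^ 2) ^ (m - 1) * ⟪z i, v i⟫ := by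
  have h := (((PiLp.proj 2 (𝕜 := ℝ) (fun _ : Fin 2 => ℂ) i).hasFDerivAt (x := z)).norm_sq).pow m
  refine ⟨_, h, fun v => ?_⟩
  simp
  ring

theorem hasFDerivAt_inner_coord (i : Fin 2) (u z : C2) :
    ∃ L : C2 →L[ℝ] ℝ, HasFDerivAt (fun x : C2 => ⟪x i, u i⟫) L z ∧ ∀ v, L v = ⟪v i, u i⟫ := by
  have h := ((innerSL ℝ (u i)).comp (PiLp.proj 2 (𝕜 := ℝ) (fun _ : Fin 2 => ℂ) i)).hasFDerivAt
    (x := z)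
  refine ⟨_, h.congr_of_eventuallyEq (Eventually.of_forall fun x => ?_), fun v => ?_⟩
  · simp [real_inner_comm]
  · simp [real_inner_comm]

/-- The defining function of the egg with exponent `m + 1`. -/
noncomputable def eggNorm (m : ℕ) (z : C2) : ℝ := (‖z 0‖ ^ 2) ^ (m + 1) + (‖z 1‖ ^ 2) ^ (m + 1)

/-- Half the derivative of `eggNorm m` divided by `m + 1`, at `z` in the direction `v`. -/
noncomputable def eggForm (m : ℕ) (z v : C2) : ℝ :=
  (‖z 0‖ ^ 2) ^ m * ⟪z 0, v 0⟫ + (‖z 1‖ ^ 2) ^ m * ⟪z 1, v 1⟫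

theorem hasFDerivAt_eggNorm (m : ℕ) (z : C2) :
    ∃ L : C2 →L[ℝ] ℝ, HasFDerivAt (eggNorm m) L z ∧ ∀ v, L v = 2 * (m + 1) * eggForm m z v := by
  obtain ⟨L0, h0, e0⟩ := hasFDerivAt_norm_sq_pow 0 (m + 1) z
  obtain ⟨L1, h1, e1⟩ := hasFDerivAt_norm_sq_pow 1 (m + 1) z
  refine ⟨L0 + L1, h0.add h1, fun v => ?_⟩
  simp only [add_apply, e0, e1, eggForm, Nat.add_sub_cancel]
  push_cast
  ring

theorem continuous_eggNorm (m : ℕ) : Continuous (eggNorm m) := by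
  unfold eggNorm; fun_prop

theorem eggExhaustion_eq (m : ℕ) (z : C2) :
    eggExhaustion (m + 1) z = 1 / (2 * (m + 1)) * Real.log (eggNorm m z) := by
  simp [eggExhaustion, eggNorm, ← pow_mul]

theorem fderiv_eggExhaustion {m : ℕ} {z : C2} (hz : eggNorm m z ≠ 0) (v : C2) :
    fderiv ℝ (eggExhaustion (m + 1)) z v = eggForm m z v / eggNorm m z := by
  obtain ⟨L, hL, e⟩ := hasFDerivAt_eggNorm m z
  have h := (hL.log hz).const_mul (1 / (2 * ((m : ℝ) + 1)))
  have h2 : HasFDerivAt (eggExhaustion (m + 1))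
      ((1 / (2 * ((m : ℝ) + 1))) • ((eggNorm m z)⁻¹ • L)) z :=
    h.congr_of_eventuallyEq (Eventually.of_forall (eggExhaustion_eq m))
  rw [h2.fderiv]
  simp only [smul_apply, e, smul_eq_mul]
  have : (m : ℝ) + 1 ≠ 0 := by positivity
  field_simp

/-- The gradient of the exhaustion function on the boundary. -/
noncomputable def eggGradient (m : ℕ) (z : C2) : C2 :=
  !₂[((‖z 0‖ ^ 2) ^ m : ℝ) • z 0, ((‖z 1‖ ^ 2) ^ m : ℝ) • z 1]

theorem gradient_eggExhaustion {m : ℕ} {z : C2} (hz : eggNorm m z = 1) :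
    ∇ (eggExhaustion (m + 1)) z = eggGradient m z := by
  refine ext_inner_right ℝ fun v => ?_
  rw [gradient, InnerProductSpace.toDual_symm_apply,
    fderiv_eggExhaustion (by rw [hz]; exact one_ne_zero), hz, div_one, PiLp.inner_apply,
    Fin.sum_univ_two]
  simp only [eggGradient, eggForm, PiLp.toLp_apply, Matrix.cons_val_zero, Matrix.cons_val_one,
    real_inner_smul_left]

theorem dc_eggExhaustion {m : ℕ} {z : C2} (hz : eggNorm m z ≠ 0) (v : C2) :
    dc (eggExhaustion (m + 1)) z v = -(eggForm m z (Complex.I • v) / eggNorm m z) := by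
  rw [dc, fderiv_eggExhaustion hz]

/-- The derivative of `x ↦ eggForm m x u` at `z` in the direction `v`. -/
noncomputable def eggHessian (m : ℕ) (z u v : C2) : ℝ :=
  (2 * m * (‖z 0‖ ^ 2) ^ (m - 1) * ⟪z 0, v 0⟫ * ⟪z 0, u 0⟫ + (‖z 0‖ ^ 2) ^ m * ⟪v 0, u 0⟫) +
  (2 * m * (‖z 1‖ ^ 2) ^ (m - 1) * ⟪z 1, v 1⟫ * ⟪z 1, u 1⟫ + (‖z 1‖ ^ 2) ^ m * ⟪v 1, u 1⟫)

theorem hasFDerivAt_eggForm (m : ℕ) (z u : C2) :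
    ∃ L : C2 →L[ℝ] ℝ, HasFDerivAt (fun x => eggForm m x u) L z ∧
      ∀ v, L v = eggHessian m z u v := by
  obtain ⟨L0, h0, e0⟩ := hasFDerivAt_norm_sq_pow 0 m z
  obtain ⟨L1, h1, e1⟩ := hasFDerivAt_norm_sq_pow 1 m z
  obtain ⟨M0, k0, f0⟩ := hasFDerivAt_inner_coord 0 u z
  obtain ⟨M1, k1, f1⟩ := hasFDerivAt_inner_coord 1 u z
  refine ⟨_, (h0.mul k0).add (h1.mul k1), fun v => ?_⟩
  simp only [add_apply, smul_apply, e0, e1, f0, f1,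
    smul_eq_mul, eggHessian]
  ring

/-- Differentiating `1 / eggNorm` produces a term with the factor `eggForm m z (I • w)`, which
vanishes by `hw`; only the Hessian term remains. -/
theorem fderiv_dc_eggExhaustion {m : ℕ} {z : C2} (hz : eggNorm m z = 1) {w : C2}
    (hw : eggForm m z (Complex.I • w) = 0) (v : C2) :
    fderiv ℝ (fun x => dc (eggExhaustion (m + 1)) x w) z v =
      -eggHessian m z (Complex.I • w) v := by
  have hev : (fun x => dc (eggExhaustion (m + 1)) x w) =ᶠ[𝓝 z]
      fun x => -(eggForm m x (Complex.I • w) * (eggNorm m x)⁻¹) := by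
    have : ∀ᶠ x in 𝓝 z, eggNorm m x ≠ 0 :=
      (continuous_eggNorm m).continuousAt.eventually_ne (by rw [hz]; exact one_ne_zero)
    filter_upwards [this] with x hx
    rw [dc_eggExhaustion hx, div_eq_mul_inv]
  obtain ⟨L, hL, e⟩ := hasFDerivAt_eggNorm m z
  obtain ⟨M, hM, f⟩ := hasFDerivAt_eggForm m z (Complex.I • w)
  have hinv := (hasDerivAt_inv (by rw [hz]; exact one_ne_zero)).comp_hasFDerivAt z hL
  have h := (hM.mul hinv).neg
  rw [hev.fderiv_eq]
  refine (congrArg (fun T : C2 →L[ℝ] ℝ => T v) (HasFDerivAt.fderiv (f := fun x =>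
    -(eggForm m x (Complex.I • w) * (eggNorm m x)⁻¹)) h)).trans ?_
  simp [hw, hz, f]

theorem real_inner_eq (a b : ℂ) : ⟪a, b⟫ = a.re * b.re + a.im * b.im := by
  rw [Complex.inner]; simp; ring

theorem real_inner_sq_add_sq (a b : ℂ) :
    ⟪a, b⟫ ^ 2 + ⟪a, Complex.I * b⟫ ^ 2 = ‖a‖ ^ 2 * ‖b‖ ^ 2 := by
  rw [real_inner_eq, real_inner_eq, ← Complex.normSq_eq_norm_sq, ← Complex.normSq_eq_norm_sq,
    Complex.normSq_apply, Complex.normSq_apply]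
  simp
  ring

theorem eggForm_neg (m : ℕ) (z v : C2) : eggForm m z (-v) = -eggForm m z v := by
  simp only [eggForm, PiLp.neg_apply, inner_neg_right]
  ring

theorem eggHessian_neg (m : ℕ) (z u v : C2) : eggHessian m z (-u) v = -eggHessian m z u v := by
  simp only [eggHessian, PiLp.neg_apply, inner_neg_right]
  ring

theorem I_smul_I_smul (v : C2) : Complex.I • Complex.I • v = -v := by
  rw [smul_smul, Complex.I_mul_I, neg_one_smul]

/-- Averaging over `v` and `I • v` gives the Levi form: `⟪a, b⟫² + ⟪a, I b⟫² = |a|²|b|²` removes the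
mixed terms. -/
theorem eggHessian_add_eggHessian (m : ℕ) (z v : C2) :
    eggHessian m z v v + eggHessian m z (Complex.I • v) (Complex.I • v) =
      2 * (m + 1) * ((‖z 0‖ ^ 2) ^ m * ‖v 0‖ ^ 2 + (‖z 1‖ ^ 2) ^ m * ‖v 1‖ ^ 2) := by
  have key : ∀ a b : ℂ, (2 * m * (‖a‖ ^ 2) ^ (m - 1) * ⟪a, b⟫ * ⟪a, b⟫ +
      (‖a‖ ^ 2) ^ m * ⟪b, b⟫) + (2 * m * (‖a‖ ^ 2) ^ (m - 1) * ⟪a, Complex.I * b⟫ *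
      ⟪a, Complex.I * b⟫ + (‖a‖ ^ 2) ^ m * ⟪Complex.I * b, Complex.I * b⟫) =
      2 * (m + 1) * ((‖a‖ ^ 2) ^ m * ‖b‖ ^ 2) := by
    intro a b
    have h1 := real_inner_sq_add_sq a b
    have h2 : (m : ℝ) * (‖a‖ ^ 2) ^ (m - 1) * ‖a‖ ^ 2 = m * (‖a‖ ^ 2) ^ m := by
      -- At `m = 0` the exponent `m - 1` is truncated, but the factor `m` vanishes.
      cases m with
      | zero => simp
      | succ k => rw [Nat.add_sub_cancel, pow_succ]; ring
    rw [real_inner_self_eq_norm_sq, real_inner_self_eq_norm_sq, norm_mul, Complex.norm_I, one_mul]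
    linear_combination (2 * m * (‖a‖ ^ 2) ^ (m - 1)) * h1 + 2 * ‖b‖ ^ 2 * h2
  have k0 := key (z 0) (v 0)
  have k1 := key (z 1) (v 1)
  simp only [eggHessian, PiLp.smul_apply, smul_eq_mul]
  linear_combination k0 + k1

/-- The density of the Monge–Ampère boundary measure with respect to the surface measure. -/
noncomputable def eggDensity (m : ℕ) (z : C2) : ℝ :=
  2 * (m + 1) * ((‖z 0‖ ^ 2) ^ m * (‖z 1‖ ^ 2) ^ m) / ‖eggGradient m z‖

theorem norm_eggGradient_sq (m : ℕ) (z : C2) : ‖eggGradient m z‖ ^ 2 =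
    ((‖z 0‖ ^ 2) ^ m * ‖z 0‖) ^ 2 + ((‖z 1‖ ^ 2) ^ m * ‖z 1‖) ^ 2 := by
  rw [EuclideanSpace.norm_sq_eq, Fin.sum_univ_two]
  simp [eggGradient]

theorem eggGradient_ne_zero {m : ℕ} {z : C2} (hz : eggNorm m z = 1) : ‖eggGradient m z‖ ≠ 0 := by
  intro h
  have h1 := norm_eggGradient_sq m z
  rw [h, zero_pow two_ne_zero] at h1
  have h2 : (‖z 0‖ ^ 2) ^ m * ‖z 0‖ = 0 := by nlinarith [sq_nonneg ((‖z 1‖ ^ 2) ^ m * ‖z 1‖)]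
  have h3 : (‖z 1‖ ^ 2) ^ m * ‖z 1‖ = 0 := by nlinarith [sq_nonneg ((‖z 0‖ ^ 2) ^ m * ‖z 0‖)]
  have h4 : eggNorm m z = (‖z 0‖ ^ 2) ^ m * ‖z 0‖ * ‖z 0‖ + (‖z 1‖ ^ 2) ^ m * ‖z 1‖ * ‖z 1‖ := by
    rw [eggNorm]; ring
  rw [h2, h3, hz] at h4
  norm_num at h4

/-- Both `τ` and `I • τ` are annihilated by `dc`, so only `dc (I • n)`, the norm of the gradient,
times the Levi form on the unit complex tangent survives. -/
theorem dcWedgeDdc_eggExhaustion {m : ℕ} {z : C2} (hz : eggNorm m z = 1) :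
    dcWedgeDdc (eggExhaustion (m + 1)) z (Complex.I • unitNormal (eggExhaustion (m + 1)) z)
      (complexTangent (unitNormal (eggExhaustion (m + 1)) z))
      (Complex.I • complexTangent (unitNormal (eggExhaustion (m + 1)) z)) = eggDensity m z := by
  have hne : eggNorm m z ≠ 0 := by rw [hz]; exact one_ne_zero
  have hM := eggGradient_ne_zero hz
  have hM2 := norm_eggGradient_sq m z
  set M := ‖eggGradient m z‖ with hMdef
  set n := unitNormal (eggExhaustion (m + 1)) z with hn
  set τ := complexTangent n with hτ
  set A := (‖z 0‖ ^ 2) ^ m with hA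
  set B := (‖z 1‖ ^ 2) ^ m with hB
  have hn' : n = M⁻¹ • eggGradient m z := by rw [hn, unitNormal, gradient_eggExhaustion hz]
  have n0 : n 0 = ((M⁻¹ * A : ℝ) : ℂ) * z 0 := by
    rw [hn', PiLp.smul_apply, Complex.real_smul]
    change ((M⁻¹ : ℝ) : ℂ) * ((A : ℝ) • z 0) = _
    rw [Complex.real_smul]; push_cast; ring
  have n1 : n 1 = ((M⁻¹ * B : ℝ) : ℂ) * z 1 := by
    rw [hn', PiLp.smul_apply, Complex.real_smul]
    change ((M⁻¹ : ℝ) : ℂ) * ((B : ℝ) • z 1) = _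
    rw [Complex.real_smul]; push_cast; ring
  have t0 : τ 0 = -(starRingEnd ℂ (n 1)) := rfl
  have t1 : τ 1 = starRingEnd ℂ (n 0) := rfl
  have fτ : eggForm m z τ = 0 := by
    rw [eggForm, t0, t1, n0, n1, real_inner_eq, real_inner_eq, ← hA, ← hB]
    simp
    ring
  have fIτ : eggForm m z (Complex.I • τ) = 0 := by
    rw [eggForm, PiLp.smul_apply, PiLp.smul_apply, t0, t1, n0, n1, real_inner_eq, real_inner_eq,
      ← hA, ← hB]
    simp
    ring
  have fn : eggForm m z n = M := by
    rw [eggForm, n0, n1, ← Complex.real_smul, ← Complex.real_smul, real_inner_smul_right,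
      real_inner_smul_right, real_inner_self_eq_norm_sq, real_inner_self_eq_norm_sq, ← hA, ← hB]
    have : A * (M⁻¹ * A * ‖z 0‖ ^ 2) + B * (M⁻¹ * B * ‖z 1‖ ^ 2) = M⁻¹ * M ^ 2 := by
      rw [hM2]; ring
    rw [this]
    field_simp
  have d1 : dc (eggExhaustion (m + 1)) z (Complex.I • n) = M := by
    rw [dc_eggExhaustion hne, I_smul_I_smul, eggForm_neg, fn, hz]; ring
  have d2 : dc (eggExhaustion (m + 1)) z τ = 0 := by
    rw [dc_eggExhaustion hne, fIτ]; simp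
  have d3 : dc (eggExhaustion (m + 1)) z (Complex.I • τ) = 0 := by
    rw [dc_eggExhaustion hne, I_smul_I_smul, eggForm_neg, fτ]; simp
  have nt0 : ‖τ 0‖ ^ 2 = (M⁻¹ * B) ^ 2 * ‖z 1‖ ^ 2 := by
    rw [t0, norm_neg, RCLike.norm_conj, n1, norm_mul, Complex.norm_real, mul_pow, Real.norm_eq_abs,
      sq_abs]
  have nt1 : ‖τ 1‖ ^ 2 = (M⁻¹ * A) ^ 2 * ‖z 0‖ ^ 2 := by
    rw [t1, RCLike.norm_conj, n0, norm_mul, Complex.norm_real, mul_pow, Real.norm_eq_abs,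
      sq_abs]
  have hAB : A * ‖z 0‖ ^ 2 + B * ‖z 1‖ ^ 2 = 1 := by
    rw [← hz, eggNorm, pow_succ _ m, pow_succ _ m]
  have dd : ddc (eggExhaustion (m + 1)) z τ (Complex.I • τ) =
      2 * (m + 1) * (A * B) * (M⁻¹) ^ 2 := by
    rw [ddc, fderiv_dc_eggExhaustion hz (by rw [I_smul_I_smul, eggForm_neg, fτ, neg_zero]),
      fderiv_dc_eggExhaustion hz fIτ, I_smul_I_smul, eggHessian_neg, neg_neg, sub_neg_eq_add,
      eggHessian_add_eggHessian, nt0, nt1]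
    -- The sum `A B² |z₂|² + B A² |z₁|²` collapses to `A B` by the boundary equation.
    linear_combination (2 * (m + 1) * (A * B) * (M⁻¹) ^ 2) * hAB
  rw [dcWedgeDdc, d1, d2, d3, dd, eggDensity, ← hA, ← hB, ← hMdef]
  field_simp
  ring

theorem measurable_eggDensity (m : ℕ) : Measurable (eggDensity m) := by
  have h : eggDensity m = fun z => 2 * (m + 1) * ((‖z 0‖ ^ 2) ^ m * (‖z 1‖ ^ 2) ^ m) /
      Real.sqrt (((‖z 0‖ ^ 2) ^ m * ‖z 0‖) ^ 2 + ((‖z 1‖ ^ 2) ^ m * ‖z 1‖) ^ 2) := by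
    ext z
    rw [eggDensity, ← norm_eggGradient_sq, Real.sqrt_sq (norm_nonneg _)]
  rw [h]
  fun_prop

theorem eggDensity_torusRot (m : ℕ) (t : Torus2) (z : C2) :
    eggDensity m (torusRot t z) = eggDensity m z := by
  have h : ‖eggGradient m (torusRot t z)‖ = ‖eggGradient m z‖ := by
    rw [← sq_eq_sq₀ (norm_nonneg _) (norm_nonneg _), norm_eggGradient_sq, norm_eggGradient_sq,
      norm_torusRot_zero, norm_torusRot_one]
  rw [eggDensity, eggDensity, h, norm_torusRot_zero, norm_torusRot_one]

theorem eggNorm_eq_one_of_mem_frontier {m : ℕ} {z : C2} (hz : z ∈ frontier (egg (m + 1))) :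
    eggNorm m z = 1 := by
  rw [frontier_egg (by omega)] at hz
  rw [eggNorm, ← pow_mul, ← pow_mul]
  exact hz

theorem norm_le_one_of_eggNorm_eq_one {m : ℕ} {z : C2} (hz : eggNorm m z = 1) :
    ‖z 0‖ ≤ 1 ∧ ‖z 1‖ ≤ 1 := by
  rw [eggNorm] at hz
  have h0 : 0 ≤ (‖z 0‖ ^ 2) ^ (m + 1) := by positivity
  have h1 : 0 ≤ (‖z 1‖ ^ 2) ^ (m + 1) := by positivity
  have e0 : ‖z 0‖ ^ 2 ≤ 1 :=
    (pow_le_one_iff_of_nonneg (n := m + 1) (by positivity) (by omega)).1 (by linarith)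
  have e1 : ‖z 1‖ ^ 2 ≤ 1 :=
    (pow_le_one_iff_of_nonneg (n := m + 1) (by positivity) (by omega)).1 (by linarith)
  exact ⟨(pow_le_one_iff_of_nonneg (norm_nonneg _) two_ne_zero).1 e0,
    (pow_le_one_iff_of_nonneg (norm_nonneg _) two_ne_zero).1 e1⟩

/-- The norms `x, y` of the two components lie in `[0, 1]`, and the boundary equation gives `x + y ≥
1`. -/
theorem norm_eggGradient_bounds {m : ℕ} {z : C2} (hz : eggNorm m z = 1) :
    1 / 2 ≤ ‖eggGradient m z‖ ∧ ‖eggGradient m z‖ ≤ 2 := by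
  obtain ⟨h0, h1⟩ := norm_le_one_of_eggNorm_eq_one hz
  have hsq := norm_eggGradient_sq m z
  rw [eggNorm, pow_succ _ m, pow_succ _ m] at hz
  have a0 := norm_nonneg (z 0)
  have a1 := norm_nonneg (z 1)
  have hA : 0 ≤ (‖z 0‖ ^ 2) ^ m := by positivity
  have hB : 0 ≤ (‖z 1‖ ^ 2) ^ m := by positivity
  have hA1 : (‖z 0‖ ^ 2) ^ m ≤ 1 := pow_le_one₀ (by positivity) (pow_le_one₀ a0 h0)
  have hB1 : (‖z 1‖ ^ 2) ^ m ≤ 1 := pow_le_one₀ (by positivity) (pow_le_one₀ a1 h1)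
  set A := (‖z 0‖ ^ 2) ^ m
  set B := (‖z 1‖ ^ 2) ^ m
  have x0 : 0 ≤ A * ‖z 0‖ := by positivity
  have y0 : 0 ≤ B * ‖z 1‖ := by positivity
  have x1 : A * ‖z 0‖ ≤ 1 := mul_le_one₀ hA1 a0 h0
  have y1 : B * ‖z 1‖ ≤ 1 := mul_le_one₀ hB1 a1 h1
  have x2 : A * ‖z 0‖ ^ 2 ≤ A * ‖z 0‖ := by nlinarith [mul_nonneg hA a0]
  have y2 : B * ‖z 1‖ ^ 2 ≤ B * ‖z 1‖ := by nlinarith [mul_nonneg hB a1]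
  set x := A * ‖z 0‖
  set y := B * ‖z 1‖
  have hxy : 1 ≤ x + y := by linarith
  constructor
  · refine (sq_le_sq₀ (by norm_num) (norm_nonneg _)).1 ?_
    rw [hsq]
    nlinarith [sq_nonneg (x - y)]
  · refine (sq_le_sq₀ (norm_nonneg _) (by norm_num)).1 ?_
    rw [hsq]
    nlinarith

theorem eggDensity_bounds {m : ℕ} {z : C2} (hz : eggNorm m z = 1) :
    (m + 1) * ((‖z 0‖ ^ 2) ^ m * (‖z 1‖ ^ 2) ^ m) ≤ eggDensity m z ∧
      eggDensity m z ≤ 4 * (m + 1) * (‖z 1‖ ^ 2) ^ m := by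
  obtain ⟨hl, hu⟩ := norm_eggGradient_bounds hz
  obtain ⟨h0, h1⟩ := norm_le_one_of_eggNorm_eq_one hz
  have hM : 0 < ‖eggGradient m z‖ := by linarith
  have hA : 0 ≤ (‖z 0‖ ^ 2) ^ m := by positivity
  have hB : 0 ≤ (‖z 1‖ ^ 2) ^ m := by positivity
  have hA1 : (‖z 0‖ ^ 2) ^ m ≤ 1 := pow_le_one₀ (by positivity) (pow_le_one₀ (norm_nonneg _) h0)
  have hAB : 0 ≤ ((m : ℝ) + 1) * ((‖z 0‖ ^ 2) ^ m * (‖z 1‖ ^ 2) ^ m) := by positivity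
  have hle : ((m : ℝ) + 1) * ((‖z 0‖ ^ 2) ^ m * (‖z 1‖ ^ 2) ^ m) ≤ (m + 1) * (‖z 1‖ ^ 2) ^ m := by
    gcongr
    exact mul_le_of_le_one_left hB hA1
  rw [eggDensity]
  constructor
  · rw [le_div_iff₀ hM]
    nlinarith
  · rw [div_le_iff₀ hM]
    have : 0 ≤ ((m : ℝ) + 1) * (‖z 1‖ ^ 2) ^ m := by positivity
    nlinarith

/-! ### Square integrable monomials for the Monge–Ampère measure -/

theorem eggOmega_eq_withDensity (m : ℕ) :
    eggOmega (m + 1) =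
      (eggSigma (m + 1)).withDensity fun z => ENNReal.ofReal (eggDensity m z) := by
  rw [eggOmega, mongeAmpereBoundaryMeasure, eggSigma]
  refine withDensity_congr_ae ?_
  filter_upwards [ae_restrict_mem (isClosed_frontier (s := egg (m + 1))).measurableSet] with z hz
  exact congrArg ENNReal.ofReal (dcWedgeDdc_eggExhaustion (eggNorm_eq_one_of_mem_frontier hz))

theorem ae_eggSigma_eggNorm (m : ℕ) : ∀ᵐ z ∂eggSigma (m + 1), eggNorm m z = 1 := by
  filter_upwards [ae_restrict_mem (isClosed_frontier (s := egg (m + 1))).measurableSet] with z hz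
  exact eggNorm_eq_one_of_mem_frontier hz

theorem lintegral_eggOmega (m : ℕ) {f : C2 → ℝ≥0∞} (hf : Measurable f) :
    ∫⁻ z, f z ∂eggOmega (m + 1) =
      ∫⁻ z, ENNReal.ofReal (eggDensity m z) * f z ∂eggSigma (m + 1) := by
  rw [eggOmega_eq_withDensity,
    lintegral_withDensity_eq_lintegral_mul _ (measurable_eggDensity m).ennreal_ofReal hf]
  rfl

theorem isEggMeasure_eggOmega (m : ℕ) : IsEggMeasure (m + 1) (eggOmega (m + 1)) := by
  have hσ := isEggMeasure_eggSigma (p := m + 1) (by omega)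
  have := hσ.finite
  have hac : eggOmega (m + 1) ≪ eggSigma (m + 1) := by
    rw [eggOmega_eq_withDensity]; exact withDensity_absolutelyContinuous _ _
  have hmd := (measurable_eggDensity m).ennreal_ofReal
  refine ⟨?_, hac.ae_le hσ.ae_norm_eq, fun t => ?_, hac.ae_le hσ.ae_fst_ne_zero,
    hac.ae_le hσ.ae_snd_ne_zero⟩
  · rw [eggOmega_eq_withDensity]
    refine isFiniteMeasure_withDensity (ne_of_lt ?_)
    calc ∫⁻ z, ENNReal.ofReal (eggDensity m z) ∂eggSigma (m + 1)
        ≤ ∫⁻ _, ENNReal.ofReal (4 * (m + 1)) ∂eggSigma (m + 1) := by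
          refine lintegral_mono_ae ?_
          filter_upwards [ae_eggSigma_eggNorm m] with z hz
          refine ENNReal.ofReal_le_ofReal ((eggDensity_bounds hz).2.trans ?_)
          have h1 := (norm_le_one_of_eggNorm_eq_one hz).2
          exact mul_le_of_le_one_right (by positivity)
            (pow_le_one₀ (by positivity) (pow_le_one₀ (norm_nonneg _) h1))
      _ < ⊤ := by
          rw [lintegral_const]
          exact ENNReal.mul_lt_top ENNReal.ofReal_lt_top (measure_lt_top _ _)
  · have hmp := hσ.measurePreserving_torusRot t
    refine ⟨hmp.measurable, Measure.ext fun s hs => ?_⟩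
    rw [Measure.map_apply hmp.measurable hs, eggOmega_eq_withDensity,
      withDensity_apply _ (hmp.measurable hs), withDensity_apply _ hs,
      ← hmp.setLIntegral_comp_preimage hs hmd]
    simp_rw [eggDensity_torusRot]

theorem not_memLp_laurentMonomial_eggOmega {m : ℕ} {n : Fin 2 → ℤ} (h0 : 0 ≤ n 0)
    (h1 : n 1 < -(m : ℤ)) : ¬ MemLp (laurentMonomial n) 2 (eggOmega (m + 1)) := by
  intro hL
  have hp : 1 ≤ m + 1 := by omega
  have htop : ∫⁻ z, ‖laurentMonomial n z‖ₑ ^ 2 ∂eggOmega (m + 1) = ⊤ := by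
    rw [lintegral_eggOmega m ((measurable_laurentMonomial n).enorm.pow_const 2)]
    refine lintegral_eggSigma_eq_top hp
      -- The powers of `1/2` bound `|z₁|^(2m)` from the density and `|z₁|^(2 n 0)` from the
      -- monomial, using `|z₁| ≥ 1/2` where `|z₂| ≤ 1/4`.
      (K := (m + 1) * ((1 / 2) ^ 2) ^ m * (1 / 2) ^ (2 * n 0)) (by positivity)
      fun z hz hz1 hz4 => ?_
    have hd := (eggDensity_bounds (eggNorm_eq_one_of_mem_frontier hz)).1
    have hl := le_norm_laurentMonomial_sq hp h0 h1 hz hz1 hz4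
    have hhalf := half_le_norm_fst hp hz hz4
    have hpos : 0 < ‖z 1‖ := norm_pos_iff.2 hz1
    rw [← ofReal_norm, ← ENNReal.ofReal_pow (norm_nonneg _),
      ← ENNReal.ofReal_mul (le_trans (by positivity) hd)]
    refine ENNReal.ofReal_le_ofReal ?_
    calc (m + 1) * ((1 / 2 : ℝ) ^ 2) ^ m * (1 / 2) ^ (2 * n 0) / ‖z 1‖ ^ 2
        = ((m + 1) * (((1 / 2 : ℝ) ^ 2) ^ m * (‖z 1‖ ^ 2) ^ m)) *
          ((1 / 2) ^ (2 * n 0) / ‖z 1‖ ^ (2 * m + 2)) := by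
          rw [← pow_mul ‖z 1‖, pow_add]
          field_simp
      _ ≤ ((m + 1) * ((‖z 0‖ ^ 2) ^ m * (‖z 1‖ ^ 2) ^ m)) * ‖laurentMonomial n z‖ ^ 2 := by
          gcongr
      _ ≤ _ := by gcongr
  rw [← eLpNorm_two_sq] at htop
  exact ENNReal.pow_ne_top hL.2.ne htop

/-- The density is at most `4(m+1)|z₂|^(2m)`, which absorbs `|z₂|^(-2(k+1))`; the integrand is then
bounded on a space of finite area. -/
theorem memLp_laurentMonomial_eggOmega {m k : ℕ} (hk : k + 1 ≤ m) :
    MemLp (laurentMonomial ![0, -((k : ℤ) + 1)]) 2 (eggOmega (m + 1)) := by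
  have hσ := isEggMeasure_eggSigma (p := m + 1) (by omega)
  have := hσ.finite
  set n : Fin 2 → ℤ := ![0, -((k : ℤ) + 1)] with hn
  refine ⟨(measurable_laurentMonomial n).aestronglyMeasurable, ?_⟩
  suffices h : eLpNorm (laurentMonomial n) 2 (eggOmega (m + 1)) ^ 2 < ⊤ by
    simpa using h
  rw [eLpNorm_two_sq, lintegral_eggOmega m ((measurable_laurentMonomial n).enorm.pow_const 2)]
  calc ∫⁻ z, ENNReal.ofReal (eggDensity m z) * ‖laurentMonomial n z‖ₑ ^ 2 ∂eggSigma (m + 1)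
      ≤ ∫⁻ _, ENNReal.ofReal (4 * (m + 1)) ∂eggSigma (m + 1) := by
        refine lintegral_mono_ae ?_
        filter_upwards [ae_eggSigma_eggNorm m, hσ.ae_snd_ne_zero] with z hz hz1
        have h1 := (norm_le_one_of_eggNorm_eq_one hz).2
        have hd := eggDensity_bounds hz
        have hpos : 0 < ‖z 1‖ := norm_pos_iff.2 hz1
        rw [← ofReal_norm, ← ENNReal.ofReal_pow (norm_nonneg _),
          ← ENNReal.ofReal_mul (le_trans (by positivity) hd.1)]
        refine ENNReal.ofReal_le_ofReal ?_
        have e : ‖laurentMonomial n z‖ ^ 2 = ((‖z 1‖ ^ 2) ^ (k + 1))⁻¹ := by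
          rw [laurentMonomial_of_ne hz1]
          have : (-((k : ℤ) + 1)) = -((k + 1 : ℕ) : ℤ) := by push_cast; ring
          simp only [hn, Matrix.cons_val_zero, Matrix.cons_val_one, zpow_zero, one_mul, this,
            zpow_neg, zpow_natCast, norm_inv, norm_pow, inv_pow]
          rw [← pow_mul, ← pow_mul, mul_comm]
        rw [e]
        calc eggDensity m z * ((‖z 1‖ ^ 2) ^ (k + 1))⁻¹
            ≤ 4 * (m + 1) * (‖z 1‖ ^ 2) ^ m * ((‖z 1‖ ^ 2) ^ (k + 1))⁻¹ := by
              gcongr; exact hd.2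
          _ ≤ 4 * (m + 1) := by
              rw [← div_eq_mul_inv, div_le_iff₀ (by positivity)]
              refine mul_le_mul_of_nonneg_left ?_ (by positivity)
              exact pow_le_pow_of_le_one (by positivity) (pow_le_one₀ (norm_nonneg _) h1) hk
    _ < ⊤ := by
        rw [lintegral_const]
        exact ENNReal.mul_lt_top ENNReal.ofReal_lt_top (measure_lt_top _ _)

/-! ### Conclusion -/

/-- A measure for which some power of `z₂⁻¹` is not square integrable charges all neighbourhoods
of `{z₂ = 0}`. -/
theorem IsEggMeasure.measure_pos_of_not_memLp {p : ℕ} {ν : Measure C2} (hν : IsEggMeasure p ν)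
    {m : ℕ} (hm : ¬ MemLp (laurentMonomial ![0, -(m : ℤ)]) 2 ν) {δ : ℝ} (hδ : 0 < δ) :
    0 < ν {z | ‖z 1‖ < δ} := by
  have := hν.finite
  by_contra h0
  have h0 : ∀ᵐ z ∂ν, z ∉ {z : C2 | ‖z 1‖ < δ} :=
    measure_eq_zero_iff_ae_notMem.1 (nonpos_iff_eq_zero.1 (not_lt.1 h0))
  refine hm (MemLp.of_bound (measurable_laurentMonomial _).aestronglyMeasurable (δ ^ m)⁻¹ ?_)
  filter_upwards [h0, hν.ae_snd_ne_zero] with z hz hz1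
  have hz : δ ≤ ‖z 1‖ := not_lt.1 hz
  rw [laurentMonomial_of_ne hz1]
  simp only [Matrix.cons_val_zero, Matrix.cons_val_one, zpow_zero, one_mul, zpow_neg,
    zpow_natCast, norm_inv, norm_pow]
  gcongr

theorem mulPowSet_zero {ν : Measure C2} (ψ : C2 → ℂ) (S : Set (Lp ℂ 2 ν)) :
    mulPowSet ψ 0 S = S := by
  ext f
  constructor
  · rintro ⟨g, hg, h⟩
    have : f = g := Lp.ext (h.trans (by simp))
    rwa [this]
  · exact fun hf => ⟨f, hf, by simp⟩

theorem theorem5p1 (p : ℕ) (hp : 1 ≤ p) :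
    (∀ k : ℕ, hardySpace (egg p) (eggSigma p) z2 k = hardySpace (egg p) (eggSigma p) z2 0) ∧
    (∀ k : ℕ, k + 1 ≤ p - 1 →
      hardySpace (egg p) (eggOmega p) z2 k ⊂ hardySpace (egg p) (eggOmega p) z2 (k + 1)) ∧
    (∀ k : ℕ, p ≤ k →
      hardySpace (egg p) (eggOmega p) z2 (p - 1) = hardySpace (egg p) (eggOmega p) z2 k) ∧
    mulPowSet z2 1 (hardySpace (egg p) (eggOmega p) z2 1) ⊂
      hardySpace (egg p) (eggOmega p) z2 0 ∧
    (∀ k : ℕ, mulPowSet z2 (k + 1) (hardySpace (egg p) (eggOmega p) z2 (k + 1)) ⊂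
      mulPowSet z2 k (hardySpace (egg p) (eggOmega p) z2 k)) := by
  obtain ⟨m, rfl⟩ : ∃ m, p = m + 1 := ⟨p - 1, by omega⟩
  rw [Nat.add_sub_cancel]
  have hσ := isEggMeasure_eggSigma hp
  have hω := isEggMeasure_eggOmega m
  -- One non-integrable pole yields mass of `ω_p` in every neighbourhood of `{z₂ = 0}`, and in
  -- particular `ω_p ≠ 0`.
  have hnot : ¬ MemLp (laurentMonomial ![0, -((m + 1 : ℕ) : ℤ)]) 2 (eggOmega (m + 1)) :=
    not_memLp_laurentMonomial_eggOmega (by simp) (by simp)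
  have hpos : ∀ δ : ℝ, 0 < δ → 0 < eggOmega (m + 1) {z | ‖z 1‖ < δ} := fun δ hδ =>
    hω.measure_pos_of_not_memLp hnot hδ
  have hne : eggOmega (m + 1) ≠ 0 := fun h => by
    have := hpos 1 one_pos
    rw [h] at this
    exact lt_irrefl _ this
  have hchain := hω.mulPowSet_hardySpace_ssubset hp hpos
  refine ⟨fun k => ?_, fun k hk => ?_, fun k hk => ?_, ?_, hchain⟩
  · exact hσ.hardySpace_eq_of_not_memLp hp
      (fun n h0 h1 => not_memLp_laurentMonomial_eggSigma hp h0 (by simpa using h1)) (Nat.zero_le k)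
  · exact hω.hardySpace_ssubset_succ hp hne (memLp_laurentMonomial_eggOmega hk)
  · exact (hω.hardySpace_eq_of_not_memLp hp
      (fun n h0 h1 => not_memLp_laurentMonomial_eggOmega h0 h1) (by omega)).symm
  · have := hchain 0
    rwa [mulPowSet_zero] at this
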